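/- Let $X\subseteq\mathbb R^n$ be a Borel set, let $F$ be a $C^1$ vector field on $X$, and suppose that for every $x\in X$ the solution $s_t(x)$ of $\dot x=F(x)$ with $s_0(x)=x$ exists and stays in $X$ for all $t\ge 0$. (For a set $S$ that need not be open, $C^1(S)$ means continuously differentiable on some open set containing $S$.) Assume that the origin is a locally (Lyapunov) stable equilibrium with local domain of attraction $N_\delta$, where $N_\delta\subseteq X$ is a Borel neighbourhood of $0$ in $X$ that is positively invariant and such that $s_t(x)\to 0$ as $t\to\infty$ for every $x\in N_\delta$. Put $X_1:=X\setminus N_\delta$. Let $h_0$ be a probability density on $X$ and $\mu_0=h_0\,dx$, and let $X_0\subseteq X$ be the Borel set on which $h_0$ is supported, i.e. $X_0=\{h_0>0\}$ up to a Lebesgue-null set. Let $p$ be a probability density on $X$ (describing the unsafe set) and let $\gamma\in\mathbb R$. Suppose that $\rho\in L_1(X_1)\cap C^1(X_1,\mathbb R_{\ge 0})$ satisfies $$\nabla\cdot(F\rho)=h_0\quad\text{a.e. on }X_1,\qquad \int_{X_1}p\,\rho\,dx\le\gamma .$$ Then: 1. $s_t(x)\to 0$ as $t\to\infty$ for Lebesgue-almost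 every $x\in X_0$, and for $\mu_0$-almost every $x$. 2. The probability of collision outside $N_\delta$ is at most $\gamma$: $$\int_0^\infty\int_{X} \mathbf 1_{X_1}(s_t(x))\,p(s_t(x))\,d\mu_0(x)\,dt\le\gamma .$$ In particular, if $p=0$ a.e. on $N_\delta$, then $\int_0^\infty\int_{X} p(s_t(x))\,d\mu_0(x)\,dt\le\gamma$. Moreover, the verification problem is a convex feasibility problem in $\rho$: the set of all $\rho$ that satisfy the conditions above is convex, and the expressions $\nabla\cdot(F\rho)$ (at the points of $X_1$, for $\rho\in C^1(X_1)$) and $\int_{X_1}p\,\rho\,dx$ (for $p\rho\in L_1(X_1)$) are linear in $\rho$. -/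

import Mathlib

open MeasureTheory Filter Topology Set

noncomputable section

/-- `n`-dimensional Euclidean space. -/
abbrev EucSpace (n : ℕ) : Type := EuclideanSpace ℝ (Fin n)

/-- `f` belongs to `C¹(S)`. The set `S` need not be open, so this means that `f` is continuously
differentiable on some open set that contains `S`. For an open set `S` this is `C¹` on `S`. -/
def IsC1On {n : ℕ} {Y : Type*} [NormedAddCommGroup Y] [NormedSpace ℝ Y]
    (f : EucSpace n → Y) (S : Set (EucSpace n)) : Prop :=
  ∃ U : Set (EucSpace n), IsOpen U ∧ S ⊆ U ∧ ContDiffOn ℝ 1 f U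

/-- The divergence `∑ i, ∂ Vᵢ / ∂ xᵢ` of a vector field at a point. -/
def divergence {n : ℕ} (V : EucSpace n → EucSpace n) (x : EucSpace n) : ℝ :=
  ∑ i : Fin n, (fderiv ℝ V x (EuclideanSpace.single i 1)) i

/-- `s t x` is, for `x ∈ X` and `t ≥ 0`, the solution at time `t` of `x' = F x` that starts at `x`,
and this solution stays in the state space `X`. At `t = 0` the derivative is one-sided. -/
structure IsSolutionFlow {n : ℕ} (F : EucSpace n → EucSpace n) (X : Set (EucSpace n))
    (s : ℝ → EucSpace n → EucSpace n) : Prop where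
  initial : ∀ x ∈ X, s 0 x = x
  mem : ∀ x ∈ X, ∀ t : ℝ, 0 ≤ t → s t x ∈ X
  deriv : ∀ x ∈ X, ∀ t : ℝ, 0 ≤ t →
    HasDerivWithinAt (fun τ => s τ x) (F (s t x)) (Ici 0) t

/-- The origin is a locally stable equilibrium with local domain of attraction `N`: it is an
equilibrium, it is Lyapunov stable, and `N` is a neighbourhood of the origin in `X`, positively
invariant under the dynamics, all of whose points are attracted to the origin. -/
structure IsLocallyStableWithDomain {n : ℕ} (F : EucSpace n → EucSpace n) (X : Set (EucSpace n))
    (s : ℝ → EucSpace n → EucSpace n) (N : Set (EucSpace n)) : Prop where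
  zero_mem : (0 : EucSpace n) ∈ X
  equilibrium : F 0 = 0
  stable : ∀ ε : ℝ, 0 < ε → ∃ η : ℝ, 0 < η ∧
    ∀ x ∈ X, ‖x‖ < η → ∀ t : ℝ, 0 ≤ t → ‖s t x‖ < ε
  subset : N ⊆ X
  nhds : N ∈ 𝓝[X] (0 : EucSpace n)
  invariant : ∀ x ∈ N, ∀ t : ℝ, 0 ≤ t → s t x ∈ N
  attracted : ∀ x ∈ N, Tendsto (fun t => s t x) atTop (𝓝 0)

/-- `h` is (a measurable representative of) a probability density function on `X`. -/
structure IsProbDensityOn {n : ℕ} (h : EucSpace n → ℝ) (X : Set (EucSpace n)) : Prop where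
  measurable : Measurable h
  nonneg : ∀ x ∈ X, 0 ≤ h x
  lintegral_eq_one : ∫⁻ x in X, ENNReal.ofReal (h x) = 1

/-- The measure on `X` with density `h`, that is `h dx`. -/
def densityMeasure {n : ℕ} (h : EucSpace n → ℝ) (X : Set (EucSpace n)) : Measure (EucSpace n) :=
  (volume.restrict X).withDensity (fun x => ENNReal.ofReal (h x))

/-- The probability of collision `∫₀^∞ ∫ p (s_t x) dμ₀ dt`, with values in `[0, ∞]`. -/
def collisionProb {n : ℕ} (s : ℝ → EucSpace n → EucSpace n) (μ₀ : Measure (EucSpace n))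
    (p : EucSpace n → ℝ) : ENNReal :=
  ∫⁻ t in Ioi (0 : ℝ), ∫⁻ x, ENNReal.ofReal (p (s t x)) ∂μ₀

/-- The dynamics solve the stochastic safety navigation problem: almost every trajectory that
starts in `X₀`, with respect to Lebesgue measure as well as with respect to `μ₀`, converges to the
target `{0}`, and the probability of collision is at most `γ`. -/
def SolvesSafeNavigation {n : ℕ} (s : ℝ → EucSpace n → EucSpace n) (X₀ : Set (EucSpace n))
    (μ₀ : Measure (EucSpace n)) (p : EucSpace n → ℝ) (γ : ℝ) : Prop :=
  (∀ᵐ x ∂(volume.restrict X₀), Tendsto (fun t => s t x) atTop (𝓝 0)) ∧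
  (∀ᵐ x ∂μ₀, Tendsto (fun t => s t x) atTop (𝓝 0)) ∧
  collisionProb s μ₀ p ≤ ENNReal.ofReal γ

/-- The feasible set of the verification problem, in the unknown `ρ`: densities
`ρ ∈ L₁(X₁) ∩ C¹(X₁, ℝ≥0)` with `∇ · (F ρ) = h₀` a.e. on `X₁` and `∫_{X₁} p ρ ≤ γ`. -/
def feasibleDensities {n : ℕ} (F : EucSpace n → EucSpace n) (X₁ : Set (EucSpace n))
    (h₀ p : EucSpace n → ℝ) (γ : ℝ) : Set (EucSpace n → ℝ) :=
  {ρ | IsC1On ρ X₁ ∧ (∀ x ∈ X₁, 0 ≤ ρ x) ∧ IntegrableOn ρ X₁ ∧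
    (∀ᵐ x ∂(volume.restrict X₁), divergence (fun y => ρ y • F y) x = h₀ x) ∧
    IntegrableOn (fun x => p x * ρ x) X₁ ∧ ∫ x in X₁, p x * ρ x ≤ γ}

end

/-!
Put `X₁ = X \ N`. The equation `∇·(F ρ) = h₀` says that, inside `X₁`, `ρ` is a stationary density
for the dynamics when mass is injected at rate `h₀`. Follow the mass that sits at `y ∈ X₁`
backwards in time: as long as the backward orbit stays in `X₁`, everything that was injected along
it is now part of `ρ`. What enters across the boundary of `X` only helps, because `ρ ≥ 0`. Hence the
occupation measure `∫₀^∞ (s_t)_* μ₀ dt` of `X₁` is dominated by `ρ dx`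
(`lintegral_outsideSet_le`). Testing this with `1` shows that the time spent in `X₁` is finite for
`μ₀`-almost every initial point; such a solution enters `N` and converges to the origin. Testing it
with `p` gives the bound on the probability of collision.

The set `X₁` is merely Borel, so the domination cannot be tested with smooth functions supported in
it. It is derived from a transport identity on the whole space. The data are replaced by compactly
supported `C¹` data `G`, `ρ'` that agree with `F`, `ρ` near a compact set `L`; then `G` has a
complete flow `φ` of Lipschitz maps, and for Lipschitz `u`
`∫ u ρ' = ∫ u ∘ φ_t ρ' + ∫₀^t ∫ u ∘ φ_τ ∇·(G ρ') dτ` (`integral_mul_eq_integral_comp_flow_add`).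
By Rademacher's theorem `u ∘ φ_t` is differentiable almost everywhere, so this is an integration by
parts, and neither the derivative of the flow in the initial point nor its Jacobian is
needed. The identity extends to Borel sets `A`, since Lipschitz functions determine a finite
measure, and if the preimages of `A` stay in the part of `X₁` in `L`, all terms have a sign, which
gives `lintegral_divergence_le`.

How long a backward orbit stays in `X₁` depends on the point. Cutting `A` into pieces according to
finitely many possible residence times and passing to all rational times yields
`lintegral_occupation_le`; the one residence time per point that the rational times may miss is
negligible by Fubini's theorem, because the flow maps preserve null sets. An exhaustion of the
common domain of `F` and `ρ` by compact sets `L` removes the truncation: each solution is in one of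
them on a bounded time interval.
-/

noncomputable section

/-! ### Complete flows of Lipschitz vector fields -/

/-- `φ` is the complete flow of the vector field `F`: `t ↦ φ t x` is the solution of `y' = F y`
through `x`, defined for all times, positive and negative. -/
structure IsCompleteFlow {E : Type*} [NormedAddCommGroup E] [NormedSpace ℝ E]
    (F : E → E) (φ : ℝ → E → E) : Prop where
  zero : ∀ x, φ 0 x = x
  hasDerivAt : ∀ x t, HasDerivAt (fun τ => φ τ x) (F (φ t x)) t

section Flow

open scoped NNReal

variable {E : Type*} [NormedAddCommGroup E] [NormedSpace ℝ E] {F : E → E} {K : ℝ≥0}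

/-- For a bounded Lipschitz field the Picard–Lindelöf theorem applies on every interval
`[-T, T]`, since the ball in which the field has to be bounded may be as large as needed. -/
lemma exists_solution_Icc [CompleteSpace E] {M : ℝ≥0} (hK : LipschitzWith K F)
    (hM : ∀ x, ‖F x‖ ≤ M) (x : E) (T : ℝ) (hT : 0 ≤ T) :
    ∃ α : ℝ → E, α 0 = x ∧ ∀ t ∈ Icc (-T) T, HasDerivWithinAt α (F (α t)) (Icc (-T) T) t := by
  have h : IsPicardLindelof (fun _ => F) (tmin := -T) (tmax := T) ⟨0, by simpa using hT⟩ x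
      (M * ⟨T, hT⟩) 0 M K := by
    apply IsPicardLindelof.of_time_independent
    · intro y _; exact hM y
    · exact hK.lipschitzOnWith
    · simp [max_self]
      rfl
  exact h.exists_eq_forall_mem_Icc_hasDerivWithinAt₀

lemma exists_isCompleteFlow [CompleteSpace E] {M : ℝ≥0} (hK : LipschitzWith K F)
    (hM : ∀ x, ‖F x‖ ≤ M) : ∃ φ : ℝ → E → E, IsCompleteFlow F φ := by
  choose α hα0 hα using fun (x : E) (k : ℕ) =>
    exists_solution_Icc hK hM x ((k : ℝ) + 1) (by positivity)
  have hd : ∀ x (k : ℕ) t, t ∈ Ioo (-((k : ℝ) + 1)) (k + 1) →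
      HasDerivAt (α x k) (F (α x k t)) t := by
    intro x k t ht
    exact (hα x k t (Ioo_subset_Icc_self ht)).hasDerivAt (Icc_mem_nhds ht.1 ht.2)
  have heq : ∀ x (k l : ℕ) t, |t| < (k : ℝ) + 1 → |t| < (l : ℝ) + 1 → α x k t = α x l t := by
    intro x k l t hk hl
    wlog hkl : k ≤ l generalizing k l
    · exact (this l k hl hk (by omega)).symm
    have hkl' : (k : ℝ) ≤ l := by exact_mod_cast hkl
    have h0 : (0 : ℝ) ∈ Ioo (-((k : ℝ) + 1)) (k + 1) := by
      constructor <;> linarith [(Nat.cast_nonneg k : (0 : ℝ) ≤ k)]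
    refine ODE_solution_unique_of_mem_Ioo (v := fun _ => F) (s := fun _ => univ) (K := K)
      (fun _ _ => hK.lipschitzOnWith) h0 (fun τ hτ => ⟨hd x k τ hτ, trivial⟩)
      (fun τ hτ => ⟨hd x l τ ⟨by linarith [hτ.1], by linarith [hτ.2]⟩, trivial⟩) ?_ (abs_lt.1 hk)
    rw [hα0, hα0]
  -- at time `t`, any solution on `[-(k + 1), k + 1]` with `|t| < k + 1` may be used
  refine ⟨fun t x => α x ⌈|t|⌉₊ t, fun x => by simp [hα0], fun x t => ?_⟩
  have hlt : |t| < (⌈|t|⌉₊ : ℝ) + 1 := by linarith [Nat.le_ceil |t|]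
  refine (hd x ⌈|t|⌉₊ t (abs_lt.1 hlt)).congr_of_eventuallyEq ?_
  have : ∀ᶠ τ in 𝓝 t, |τ| < (⌈|t|⌉₊ : ℝ) + 1 :=
    continuous_abs.continuousAt.eventually_lt continuousAt_const hlt
  filter_upwards [this] with τ hτ
  exact heq x _ _ τ (by linarith [Nat.le_ceil |τ|]) hτ

namespace IsCompleteFlow

variable {φ : ℝ → E → E}

lemma eq_of_hasDerivAt (h : IsCompleteFlow F φ) (hK : LipschitzWith K F) {y : ℝ → E}
    (hy : ∀ t, HasDerivAt y (F (y t)) t) (t : ℝ) : y t = φ t (y 0) := by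
  have := ODE_solution_unique_univ (v := fun _ => F) (s := fun _ => univ) (K := K) (t₀ := 0)
    (f := y) (g := fun t => φ t (y 0)) (fun _ => hK.lipschitzOnWith) (fun t => ⟨hy t, trivial⟩)
    (fun t => ⟨h.hasDerivAt _ t, trivial⟩) (h.zero _).symm
  exact congrFun this t

lemma add (h : IsCompleteFlow F φ) (hK : LipschitzWith K F) (a b : ℝ) (x : E) :
    φ (a + b) x = φ a (φ b x) := by
  have := h.eq_of_hasDerivAt hK (y := fun t => φ (t + b) x)
    (fun t => (h.hasDerivAt x (t + b)).comp_add_const t b) a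
  simpa using this

lemma neg_apply (h : IsCompleteFlow F φ) (hK : LipschitzWith K F) (t : ℝ) (x : E) :
    φ (-t) (φ t x) = x := by
  rw [← h.add hK, neg_add_cancel, h.zero]

lemma apply_neg (h : IsCompleteFlow F φ) (hK : LipschitzWith K F) (t : ℝ) (x : E) :
    φ t (φ (-t) x) = x := by
  rw [← h.add hK, add_neg_cancel, h.zero]

lemma neg (h : IsCompleteFlow F φ) : IsCompleteFlow (fun x => -F x) (fun t => φ (-t)) where
  zero x := by simp [h.zero]
  hasDerivAt x t := by
    simpa [Function.comp_def] using (h.hasDerivAt x (-t)).scomp t (hasDerivAt_neg t)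

lemma continuous_time (h : IsCompleteFlow F φ) (x : E) : Continuous fun t => φ t x :=
  continuous_iff_continuousAt.2 fun t => (h.hasDerivAt x t).continuousAt

lemma dist_le_of_nonneg (h : IsCompleteFlow F φ) (hK : LipschitzWith K F) {t : ℝ} (ht : 0 ≤ t)
    (x y : E) : dist (φ t x) (φ t y) ≤ dist x y * Real.exp (K * t) := by
  have := dist_le_of_trajectories_ODE (v := fun _ => F) (K := K) (a := 0) (b := t)
    (f := fun t => φ t x) (g := fun t => φ t y) (δ := dist x y) (fun _ => hK)
    (h.continuous_time x).continuousOn (fun τ _ => (h.hasDerivAt x τ).hasDerivWithinAt)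
    (h.continuous_time y).continuousOn (fun τ _ => (h.hasDerivAt y τ).hasDerivWithinAt)
    (by simp [h.zero]) t ⟨ht, le_rfl⟩
  simpa using this

lemma dist_le (h : IsCompleteFlow F φ) (hK : LipschitzWith K F) (t : ℝ) (x y : E) :
    dist (φ t x) (φ t y) ≤ dist x y * Real.exp (K * |t|) := by
  rcases le_total 0 t with ht | ht
  · rw [abs_of_nonneg ht]; exact h.dist_le_of_nonneg hK ht x y
  · rw [abs_of_nonpos ht]
    simpa using h.neg.dist_le_of_nonneg hK.neg (neg_nonneg.2 ht) x y

lemma lipschitzWith (h : IsCompleteFlow F φ) (hK : LipschitzWith K F) (t : ℝ) :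
    LipschitzWith (Real.toNNReal (Real.exp (K * |t|))) (φ t) :=
  LipschitzWith.of_dist_le_mul fun x y => by
    rw [Real.coe_toNNReal _ (Real.exp_pos _).le, mul_comm]
    exact h.dist_le hK t x y

lemma continuous (h : IsCompleteFlow F φ) (hK : LipschitzWith K F) :
    Continuous fun q : ℝ × E => φ q.1 q.2 := by
  rw [continuous_iff_continuousAt]
  rintro ⟨t, x⟩
  have h1 : Tendsto (fun q : ℝ × E => dist q.2 x * Real.exp (K * |q.1|) + dist (φ q.1 x) (φ t x))
      (𝓝 (t, x)) (𝓝 0) := by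
    have hc : Continuous fun q : ℝ × E =>
        dist q.2 x * Real.exp (K * |q.1|) + dist (φ q.1 x) (φ t x) := by
      have := (h.continuous_time x).comp (continuous_fst (X := ℝ) (Y := E))
      have h3 : Continuous fun q : ℝ × E => φ q.1 x := this
      exact (((continuous_snd.dist continuous_const).mul (Real.continuous_exp.comp
        (continuous_const.mul continuous_fst.abs)))).add (h3.dist continuous_const)
    simpa using hc.tendsto (t, x)
  refine tendsto_iff_dist_tendsto_zero.2 (squeeze_zero (fun _ => dist_nonneg) (fun q => ?_) h1)
  exact (dist_triangle _ (φ q.1 x) _).trans (by gcongr; exact h.dist_le hK _ _ _)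

/-- A forward solution on `[0, T]` with one-sided derivatives is a flow line. -/
lemma eqOn_of_hasDerivWithinAt (h : IsCompleteFlow F φ) (hK : LipschitzWith K F) {y : ℝ → E}
    {T : ℝ} (hc : ContinuousOn y (Icc 0 T))
    (hy : ∀ t ∈ Ico 0 T, HasDerivWithinAt y (F (y t)) (Ici t) t) :
    EqOn y (fun t => φ t (y 0)) (Icc 0 T) :=
  ODE_solution_unique (v := fun _ => F) (fun _ => hK) hc hy
    (h.continuous_time _).continuousOn (fun τ _ => (h.hasDerivAt _ τ).hasDerivWithinAt)
    (h.zero _).symm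

lemma norm_sub_le (h : IsCompleteFlow F φ) {M : ℝ} (hM : ∀ x, ‖F x‖ ≤ M) (x : E) (t : ℝ) :
    ‖φ t x - x‖ ≤ M * |t| := by
  have := convex_univ.norm_image_sub_le_of_norm_hasDerivWithin_le (𝕜 := ℝ)
    (f := fun τ => φ τ x) (C := M) (fun τ _ => (h.hasDerivAt x τ).hasDerivWithinAt)
    (fun τ _ => hM _) (mem_univ 0) (mem_univ t)
  simpa [h.zero] using this

end IsCompleteFlow

end Flow

/-- A Lipschitz self-map of Euclidean space sends Lebesgue null sets to null sets, because Lebesgue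
measure is a multiple of the `n`-dimensional Hausdorff measure. -/
lemma LipschitzWith.volume_image_eq_zero {n : ℕ} {f : EucSpace n → EucSpace n} {C : NNReal}
    (hf : LipschitzWith C f) {S : Set (EucSpace n)} (hS : volume S = 0) :
    volume (f '' S) = 0 := by
  have hH := MeasureTheory.isAddHaarMeasure_hausdorffMeasure (E := EucSpace n)
  have h1 : Measure.hausdorffMeasure (Module.finrank ℝ (EucSpace n)) S = 0 :=
    Measure.absolutelyContinuous_isAddHaarMeasure _ volume hS
  have h2 : Measure.hausdorffMeasure (Module.finrank ℝ (EucSpace n)) (f '' S) = 0 := by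
    have := hf.hausdorffMeasure_image_le (d := Module.finrank ℝ (EucSpace n)) (by positivity) S
    rw [h1, mul_zero] at this
    exact le_antisymm this bot_le
  exact Measure.absolutelyContinuous_isAddHaarMeasure volume _ h2

lemma IsCompleteFlow.quasiMeasurePreserving {n : ℕ} {F : EucSpace n → EucSpace n} {K : NNReal}
    {φ : ℝ → EucSpace n → EucSpace n} (h : IsCompleteFlow F φ) (hK : LipschitzWith K F) (t : ℝ) :
    Measure.QuasiMeasurePreserving (φ t) volume volume := by
  refine ⟨(h.lipschitzWith hK t).continuous.measurable, Measure.AbsolutelyContinuous.mk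
    fun S hS h0 => ?_⟩
  rw [Measure.map_apply (h.lipschitzWith hK t).continuous.measurable hS]
  have : φ t ⁻¹' S = φ (-t) '' S := by
    ext x
    constructor
    · intro hx; exact ⟨φ t x, hx, h.neg_apply hK t x⟩
    · rintro ⟨y, hy, rfl⟩
      simpa [h.apply_neg hK] using hy
  rw [this]
  exact (h.lipschitzWith hK (-t)).volume_image_eq_zero h0

/-! ### The transport identity for Lipschitz test functions -/

section Transport

variable {n : ℕ}

lemma fderiv_apply_apply {V : EucSpace n → EucSpace n} {x : EucSpace n}
    (hV : DifferentiableAt ℝ V x) (v : EucSpace n) (i : Fin n) :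
    fderiv ℝ (fun y => V y i) x v = fderiv ℝ V x v i := by
  have h : HasFDerivAt (fun y => V y i)
      ((EuclideanSpace.proj i : EucSpace n →L[ℝ] ℝ).comp (fderiv ℝ V x)) x :=
    (EuclideanSpace.proj i : EucSpace n →L[ℝ] ℝ).hasFDerivAt.comp x hV.hasFDerivAt
  rw [h.fderiv]; rfl

lemma contDiff_coord {V : EucSpace n → EucSpace n} (hV : ContDiff ℝ 1 V) (i : Fin n) :
    ContDiff ℝ 1 fun y => V y i :=
  (EuclideanSpace.proj i : EucSpace n →L[ℝ] ℝ).contDiff.comp hV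

lemma continuous_divergence {V : EucSpace n → EucSpace n} (hV : ContDiff ℝ 1 V) :
    Continuous (divergence V) := by
  unfold divergence
  refine continuous_finsetSum _ fun i _ => ?_
  have h1 : Continuous fun x => fderiv ℝ V x (EuclideanSpace.single i 1) :=
    (hV.continuous_fderiv one_ne_zero).clm_apply continuous_const
  exact (EuclideanSpace.proj i : EucSpace n →L[ℝ] ℝ).continuous.comp h1

lemma hasCompactSupport_divergence {V : EucSpace n → EucSpace n} (hV : HasCompactSupport V) :
    HasCompactSupport (divergence V) := by
  refine (hV.fderiv ℝ).mono fun x hx => ?_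
  contrapose! hx
  simp only [Function.mem_support, not_not] at hx ⊢
  simp [divergence, hx]

/-- Integration by parts against a Lipschitz function, which by Rademacher's theorem is
differentiable almost everywhere. -/
lemma integral_fderiv_apply_eq_neg_integral_mul_divergence {v : EucSpace n → ℝ} {C : NNReal}
    (hv : LipschitzWith C v) {G : EucSpace n → EucSpace n} (hG : ContDiff ℝ 1 G)
    (hGc : HasCompactSupport G) :
    ∫ x, fderiv ℝ v x (G x) = -∫ x, v x * divergence G x := by
  have hGi : ∀ i, HasCompactSupport fun x => G x i := fun i =>
    hGc.comp_left (g := fun y : EucSpace n => y i) rfl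
  have hsum : ∀ y : EucSpace n, y = ∑ i, y i • EuclideanSpace.single i (1 : ℝ) := fun y => by
    simpa using ((EuclideanSpace.basisFun (Fin n) ℝ).sum_repr y).symm
  have h1 : ∀ᵐ x, fderiv ℝ v x (G x) =
      ∑ i, lineDeriv ℝ v x (EuclideanSpace.single i 1) * G x i := by
    filter_upwards [hv.ae_differentiableAt] with x hx
    conv_lhs => rw [hsum (G x)]
    simp [map_sum, hx.lineDeriv_eq_fderiv, mul_comm]
  have hint1 : ∀ i, Integrable fun x =>
      lineDeriv ℝ v x (EuclideanSpace.single i 1) * G x i := fun i => by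
    refine (((contDiff_coord hG i).continuous.integrable_of_hasCompactSupport (hGi i)).bdd_mul
      (c := C * ‖EuclideanSpace.single i (1 : ℝ)‖)
      (aestronglyMeasurable_lineDeriv hv.continuous volume) ?_)
    exact .of_forall fun x => norm_lineDeriv_le_of_lipschitz ℝ hv
  have hd : ∀ i x, lineDeriv ℝ (fun y => G y i) x (-EuclideanSpace.single i 1) =
      -(fderiv ℝ G x (EuclideanSpace.single i 1) i) := fun i x => by
    have hdx := hG.differentiable one_ne_zero x
    rw [((contDiff_coord hG i).differentiable one_ne_zero x).lineDeriv_eq_fderiv, map_neg,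
      fderiv_apply_apply hdx]
  have hint2 : ∀ i, Integrable fun x =>
      v x * (fderiv ℝ G x (EuclideanSpace.single i 1) i) := fun i => by
    have hc : Continuous fun x => fderiv ℝ G x (EuclideanSpace.single i 1) i :=
      (EuclideanSpace.proj i : EucSpace n →L[ℝ] ℝ).continuous.comp
        ((hG.continuous_fderiv one_ne_zero).clm_apply continuous_const)
    refine (hv.continuous.mul hc).integrable_of_hasCompactSupport ?_
    refine (hGc.fderiv ℝ).mono fun x hx => ?_
    contrapose! hx
    simp only [Function.mem_support, not_not] at hx ⊢
    simp [hx]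
  rw [integral_congr_ae h1, integral_finsetSum _ fun i _ => hint1 i]
  simp only [divergence, Finset.mul_sum]
  rw [integral_finsetSum _ fun i _ => hint2 i, ← Finset.sum_neg_distrib]
  refine Finset.sum_congr rfl fun i _ => ?_
  obtain ⟨D, hD⟩ := ContDiff.lipschitzWith_of_hasCompactSupport (hGi i) (contDiff_coord hG i)
    one_ne_zero
  rw [hv.integral_lineDeriv_mul_eq hD (hGi i), ← integral_neg]
  refine integral_congr_ae (.of_forall fun x => ?_)
  simp only [hd]
  ring

variable {F : EucSpace n → EucSpace n} {φ : ℝ → EucSpace n → EucSpace n} {ρ : EucSpace n → ℝ}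

lemma hasDerivAt_integral_comp_flow_zero (hF : ContDiff ℝ 1 F) (hFc : HasCompactSupport F)
    (hφ : IsCompleteFlow F φ) (hρ : ContDiff ℝ 1 ρ) (hρc : HasCompactSupport ρ)
    {v : EucSpace n → ℝ} {C : NNReal} (hv : LipschitzWith C v) :
    HasDerivAt (fun ε => ∫ x, v (φ ε x) * ρ x)
      (-∫ x, v x * divergence (fun y => ρ y • F y) x) 0 := by
  obtain ⟨K, hK⟩ := ContDiff.lipschitzWith_of_hasCompactSupport hFc hF one_ne_zero
  obtain ⟨M, hM⟩ := hFc.exists_bound_of_continuous hF.continuous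
  have hM0 : 0 ≤ M := (norm_nonneg _).trans (hM 0)
  have hcont : ∀ ε, Continuous fun x => v (φ ε x) * ρ x := fun ε =>
    (hv.continuous.comp (hφ.lipschitzWith hK ε).continuous).mul hρ.continuous
  have hmeasd : AEStronglyMeasurable (fun x => fderiv ℝ v x (F x) * ρ x) volume := by
    refine AEStronglyMeasurable.mul ?_ hρ.continuous.aestronglyMeasurable
    have hm : Measurable fun x => fderiv ℝ v x (F x) := by
      have h1 : Measurable fun x => fderiv ℝ v x := measurable_fderiv ℝ v
      exact ((isBoundedBilinearMap_apply (𝕜 := ℝ) (E := EucSpace n)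
        (F := ℝ)).continuous.measurable.comp (h1.prodMk hF.continuous.measurable))
    exact hm.aestronglyMeasurable
  have key := (hasDerivAt_integral_of_dominated_loc_of_lip (μ := volume) (𝕜 := ℝ)
    (F := fun ε x => v (φ ε x) * ρ x) (F' := fun x => fderiv ℝ v x (F x) * ρ x)
    (x₀ := (0 : ℝ)) (s := univ) (bound := fun x => C * M * |ρ x|) univ_mem
    (.of_forall fun ε => (hcont ε).aestronglyMeasurable)
    ((hcont 0).integrable_of_hasCompactSupport hρc.mul_left) hmeasd ?_ ?_ ?_).2
  · have h2 : ∫ x, fderiv ℝ v x (F x) * ρ x = ∫ x, fderiv ℝ v x (ρ x • F x) := by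
      refine integral_congr_ae (.of_forall fun x => ?_)
      simp [mul_comm]
    have h3 := integral_fderiv_apply_eq_neg_integral_mul_divergence hv
      (G := fun y => ρ y • F y) (hρ.smul hF) hρc.smul_right
    rwa [h2, h3] at key
  · refine .of_forall fun x => LipschitzOnWith.of_dist_le_mul fun a _ b _ => ?_
    have h3 : ‖φ a x - φ b x‖ ≤ M * |a - b| := by
      have := hφ.norm_sub_le hM (φ b x) (a - b)
      rwa [← hφ.add hK, sub_add_cancel] at this
    have h4 : |v (φ a x) - v (φ b x)| ≤ C * (M * |a - b|) := by
      have := hv.dist_le_mul (φ a x) (φ b x)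
      rw [Real.dist_eq, dist_eq_norm] at this
      exact this.trans (by gcongr)
    rw [Real.dist_eq, ← sub_mul, abs_mul, Real.coe_nnabs, Real.dist_eq,
      abs_of_nonneg (by positivity : 0 ≤ C * M * |ρ x|)]
    calc _ ≤ C * (M * |a - b|) * |ρ x| := by gcongr
      _ = _ := by ring
  · exact ((hρ.continuous.abs.integrable_of_hasCompactSupport hρc.norm)).const_mul _
  · filter_upwards [hv.ae_differentiableAt] with x hx
    have h5 : HasFDerivAt v (fderiv ℝ v x) (φ 0 x) := by
      rw [hφ.zero]; exact hx.hasFDerivAt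
    have h6 := hφ.hasDerivAt x 0
    rw [hφ.zero] at h6
    exact (h5.comp_hasDerivAt (0 : ℝ) h6).mul_const _

/-- The transport identity: along the flow, `∫ u (φ t x) ρ x dx` changes at the rate
`-∫ u (φ t x) ∇·(F ρ) x dx`. -/
lemma integral_mul_eq_integral_comp_flow_add (hF : ContDiff ℝ 1 F) (hFc : HasCompactSupport F)
    (hφ : IsCompleteFlow F φ) (hρ : ContDiff ℝ 1 ρ) (hρc : HasCompactSupport ρ)
    {u : EucSpace n → ℝ} {C : NNReal} (hu : LipschitzWith C u) (t : ℝ) :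
    ∫ x, u x * ρ x = (∫ x, u (φ t x) * ρ x) +
      ∫ τ in (0 : ℝ)..t, ∫ x, u (φ τ x) * divergence (fun y => ρ y • F y) x := by
  obtain ⟨K, hK⟩ := ContDiff.lipschitzWith_of_hasCompactSupport hFc hF one_ne_zero
  set w := divergence fun y => ρ y • F y with hw
  have hwc : Continuous w := continuous_divergence (hρ.smul hF)
  have hws : HasCompactSupport w := hasCompactSupport_divergence hρc.smul_right
  have hderiv : ∀ τ, HasDerivAt (fun τ => ∫ x, u (φ τ x) * ρ x)
      (-∫ x, u (φ τ x) * w x) τ := by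
    intro τ
    -- by the group property it suffices to differentiate at time `0`, with `u ∘ φ τ` for `u`
    have h1 := hasDerivAt_integral_comp_flow_zero hF hFc hφ hρ hρc
      (hu.comp (hφ.lipschitzWith hK τ))
    have h2 : HasDerivAt (fun a => ∫ x, (u ∘ φ τ) (φ (a - τ) x) * ρ x)
        (-∫ x, (u ∘ φ τ) x * w x) τ := by
      have h1' : HasDerivAt (fun ε => ∫ x, (u ∘ φ τ) (φ ε x) * ρ x)
        (-∫ x, (u ∘ φ τ) x * w x) (τ - τ) := by rw [sub_self]; exact h1
      exact h1'.comp_sub_const τ τ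
    convert! h2 using 5 with a x
    simp [← hφ.add hK]
  have hcont : Continuous fun τ => -∫ x, u (φ τ x) * w x := by
    refine (continuous_iff_continuousAt.2 fun τ₀ => ?_).neg
    have hjoint : Continuous fun q : ℝ × EucSpace n => u (φ q.1 q.2) * w q.2 :=
      (hu.continuous.comp (hφ.continuous hK)).mul (hwc.comp continuous_snd)
    have h1 := continuous_parametric_integral_of_continuous (μ := volume)
      (f := fun τ x => u (φ τ x) * w x) hjoint hws.isCompact
    have h2 : ∀ τ, ∫ x in tsupport w, u (φ τ x) * w x = ∫ x, u (φ τ x) * w x := fun τ =>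
      setIntegral_eq_integral_of_forall_compl_eq_zero fun x hx => by
        rw [image_eq_zero_of_notMem_tsupport hx, mul_zero]
    simp only [h2] at h1
    exact h1.continuousAt
  have h := intervalIntegral.integral_eq_sub_of_hasDerivAt (a := 0) (b := t)
    (fun τ _ => hderiv τ) (hcont.intervalIntegrable _ _)
  simp only [hφ.zero, intervalIntegral.integral_neg] at h
  linarith

end Transport

/-! ### The transport identity for measures -/

/-- Bounded Lipschitz functions determine a finite Borel measure: they approximate the indicators
of closed sets. -/
lemma ext_of_forall_integral_lipschitz_eq {Ω : Type*} [MeasurableSpace Ω] [PseudoMetricSpace Ω]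
    [BorelSpace Ω] {μ ν : Measure Ω} [IsFiniteMeasure μ] [IsFiniteMeasure ν]
    (h : ∀ (u : Ω → ℝ) (C : NNReal), LipschitzWith C u → (∀ x, |u x| ≤ 1) →
      ∫ x, u x ∂μ = ∫ x, u x ∂ν) : μ = ν := by
  have key : ∀ A : Set Ω, IsClosed A → μ A = ν A := by
    intro A hA
    have hpos : ∀ k : ℕ, (0 : ℝ) < 1 / ((k : ℝ) + 1) := fun k => by positivity
    have h1 := tendsto_integral_thickenedIndicator_of_isClosed μ hA hpos
      tendsto_one_div_add_atTop_nhds_zero_nat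
    have h2 := tendsto_integral_thickenedIndicator_of_isClosed ν hA hpos
      tendsto_one_div_add_atTop_nhds_zero_nat
    have h3 : ∀ k, ∫ x, (thickenedIndicator (hpos k) A x : ℝ) ∂μ =
        ∫ x, (thickenedIndicator (hpos k) A x : ℝ) ∂ν := fun k => by
      refine h _ _ (lipschitzWith_thickenedIndicator (hpos k) A) fun x => ?_
      rw [abs_of_nonneg (NNReal.coe_nonneg _)]
      exact_mod_cast thickenedIndicator_le_one (hpos k) A x
    simp only [h3] at h1
    exact (measureReal_eq_measureReal_iff).1 (tendsto_nhds_unique h1 h2)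
  refine ext_of_generate_finite _ ?_ isPiSystem_isClosed (fun A hA => key A hA)
    (key univ isClosed_univ)
  rw [BorelSpace.measurable_eq (α := Ω), borel_eq_generateFrom_isClosed]

section TransportMeasure

variable {n : ℕ}

/-- The measure with density `max (g x) 0` with respect to Lebesgue measure. -/
def posPartMeasure (g : EucSpace n → ℝ) : Measure (EucSpace n) :=
  volume.withDensity fun x => ENNReal.ofReal (g x)

/-- The measure accumulated on the time interval `(0, t]` when mass is injected at rate
`posPartMeasure g` and then carried along by `φ`. -/
def accumulatedMeasure (φ : ℝ → EucSpace n → EucSpace n) (g : EucSpace n → ℝ) (t : ℝ) :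
    Measure (EucSpace n) :=
  (((volume : Measure ℝ).restrict (Ioc 0 t)).prod (posPartMeasure g)).map fun q => φ q.1 q.2

lemma isFiniteMeasure_posPartMeasure {g : EucSpace n → ℝ} (hg : Continuous g)
    (hgc : HasCompactSupport g) : IsFiniteMeasure (posPartMeasure g) :=
  isFiniteMeasure_withDensity_ofReal (hg.integrable_of_hasCompactSupport hgc).2

lemma integral_posPartMeasure_sub {g : EucSpace n → ℝ} (hg : Continuous g)
    (hgc : HasCompactSupport g) {u : EucSpace n → ℝ} (hu : Continuous u) :
    ∫ x, u x ∂posPartMeasure g - ∫ x, u x ∂posPartMeasure (fun x => -g x) =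
      ∫ x, u x * g x := by
  have h1 : ∀ g : EucSpace n → ℝ, Continuous g →
      ∫ x, u x ∂posPartMeasure g = ∫ x, u x * max (g x) 0 := fun g hg => by
    rw [posPartMeasure, integral_withDensity_eq_integral_toReal_smul (by fun_prop)
      (.of_forall fun _ => ENNReal.ofReal_lt_top)]
    simp [ENNReal.toReal_ofReal', mul_comm]
  have h2 : ∀ g : EucSpace n → ℝ, Continuous g → HasCompactSupport g →
      Integrable fun x => u x * max (g x) 0 := fun g hg hgc => by
    refine (hu.mul (hg.max continuous_const)).integrable_of_hasCompactSupport ?_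
    exact (hgc.comp_left (g := fun y : ℝ => max y 0) (by simp)).mul_left
  rw [h1 g hg, h1 (fun x => -g x) hg.neg,
    ← integral_sub (h2 g hg hgc) (h2 (fun x => -g x) hg.neg hgc.neg)]
  refine integral_congr_ae (.of_forall fun x => ?_)
  change u x * max (g x) 0 - u x * max (-g x) 0 = u x * g x
  rw [← mul_sub, max_zero_sub_max_neg_zero_eq_self]

lemma posPartMeasure_apply (g : EucSpace n → ℝ) {A : Set (EucSpace n)} (hA : MeasurableSet A) :
    posPartMeasure g A = ∫⁻ x in A, ENNReal.ofReal (g x) :=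
  withDensity_apply _ hA

variable {φ : ℝ → EucSpace n → EucSpace n}

lemma accumulatedMeasure_apply (hφ : Continuous fun q : ℝ × EucSpace n => φ q.1 q.2)
    {g : EucSpace n → ℝ} [IsFiniteMeasure (posPartMeasure g)] (t : ℝ) {A : Set (EucSpace n)}
    (hA : MeasurableSet A) :
    accumulatedMeasure φ g t A =
      ∫⁻ τ in Ioc 0 t, ∫⁻ x in φ τ ⁻¹' A, ENNReal.ofReal (g x) := by
  rw [accumulatedMeasure, Measure.map_apply hφ.measurable hA,
    Measure.prod_apply (hφ.measurable hA)]
  refine lintegral_congr fun τ => ?_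
  have h1 : Continuous (φ τ) := hφ.comp (Continuous.prodMk_right τ)
  rw [← posPartMeasure_apply g (h1.measurable hA)]
  rfl

lemma isFiniteMeasure_accumulatedMeasure (g : EucSpace n → ℝ)
    [IsFiniteMeasure (posPartMeasure g)] (t : ℝ) : IsFiniteMeasure (accumulatedMeasure φ g t) := by
  unfold accumulatedMeasure; infer_instance

lemma integral_accumulatedMeasure (hφ : Continuous fun q : ℝ × EucSpace n => φ q.1 q.2)
    {g : EucSpace n → ℝ} [IsFiniteMeasure (posPartMeasure g)] (t : ℝ) {u : EucSpace n → ℝ}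
    (hu : Continuous u) (hub : ∀ x, |u x| ≤ 1) :
    IntegrableOn (fun τ => ∫ x, u (φ τ x) ∂posPartMeasure g) (Ioc 0 t) ∧
    ∫ x, u x ∂accumulatedMeasure φ g t =
      ∫ τ in Ioc 0 t, ∫ x, u (φ τ x) ∂posPartMeasure g := by
  have hint : Integrable (fun q : ℝ × EucSpace n => u (φ q.1 q.2))
      (((volume : Measure ℝ).restrict (Ioc 0 t)).prod (posPartMeasure g)) :=
    Integrable.of_bound (hu.comp hφ).aestronglyMeasurable 1 (.of_forall fun q => hub _)
  refine ⟨hint.integral_prod_left, ?_⟩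
  rw [accumulatedMeasure, integral_map hφ.aemeasurable hu.aestronglyMeasurable,
    integral_prod _ hint]

variable {F : EucSpace n → EucSpace n} {ρ : EucSpace n → ℝ}

/-- The transport identity as an equality of measures: the mass of `ρ` equals the mass of `ρ`
transported for time `t` plus the mass that the source `∇·(F ρ)` has contributed meanwhile.
Positive and negative parts are on different sides, so that all the measures are positive. -/
lemma posPartMeasure_add_map_add_accumulatedMeasure (hF : ContDiff ℝ 1 F)
    (hFc : HasCompactSupport F) (hφ : IsCompleteFlow F φ) (hρ : ContDiff ℝ 1 ρ)
    (hρc : HasCompactSupport ρ) {t : ℝ} (ht : 0 ≤ t) :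
    posPartMeasure ρ + (posPartMeasure fun x => -ρ x).map (φ t) +
        accumulatedMeasure φ (fun x => -divergence (fun y => ρ y • F y) x) t =
      (posPartMeasure fun x => -ρ x) + (posPartMeasure ρ).map (φ t) +
        accumulatedMeasure φ (divergence fun y => ρ y • F y) t := by
  obtain ⟨K, hK⟩ := ContDiff.lipschitzWith_of_hasCompactSupport hFc hF one_ne_zero
  set w := divergence fun y => ρ y • F y with hw
  have hwc : Continuous w := continuous_divergence (hρ.smul hF)
  have hws : HasCompactSupport w := hasCompactSupport_divergence hρc.smul_right
  have hφc := hφ.continuous hK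
  have hφt := (hφ.lipschitzWith hK t).continuous
  have i1 := isFiniteMeasure_posPartMeasure hρ.continuous hρc
  have i2 := isFiniteMeasure_posPartMeasure hρ.continuous.neg hρc.neg
  have i3 := isFiniteMeasure_posPartMeasure hwc hws
  have i4 := isFiniteMeasure_posPartMeasure hwc.neg hws.neg
  have i5 := isFiniteMeasure_accumulatedMeasure (φ := φ) w t
  have i6 : IsFiniteMeasure (accumulatedMeasure φ (fun x => -w x) t) :=
    isFiniteMeasure_accumulatedMeasure (φ := φ) _ t
  have i2' : IsFiniteMeasure (posPartMeasure fun x => -ρ x) := i2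
  refine ext_of_forall_integral_lipschitz_eq fun u C hu hub => ?_
  have hint : ∀ μ : Measure (EucSpace n), IsFiniteMeasure μ → Integrable u μ := fun μ _ =>
    Integrable.of_bound hu.continuous.aestronglyMeasurable 1 (.of_forall fun q => hub _)
  rw [integral_add_measure (hint _ inferInstance) (hint _ inferInstance),
    integral_add_measure (hint _ inferInstance) (hint _ inferInstance),
    integral_add_measure (hint _ inferInstance) (hint _ inferInstance),
    integral_add_measure (hint _ inferInstance) (hint _ inferInstance),
    integral_map hφt.aemeasurable hu.continuous.aestronglyMeasurable,
    integral_map hφt.aemeasurable hu.continuous.aestronglyMeasurable]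
  obtain ⟨j1, e1⟩ := integral_accumulatedMeasure hφc (g := w) t hu.continuous hub
  obtain ⟨j2, e2⟩ := integral_accumulatedMeasure hφc (g := fun x => -w x) t hu.continuous hub
  have e3 := integral_sub j1 j2
  have e4 := integral_posPartMeasure_sub hρ.continuous hρc hu.continuous
  have e5 := integral_posPartMeasure_sub hρ.continuous hρc (hu.continuous.comp hφt)
  have e6 : ∀ τ, ∫ x, u (φ τ x) ∂posPartMeasure w -
      ∫ x, u (φ τ x) ∂posPartMeasure (fun x => -w x) = ∫ x, u (φ τ x) * w x := fun τ =>
    integral_posPartMeasure_sub hwc hws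
      (hu.continuous.comp (hφ.lipschitzWith hK τ).continuous)
  simp only [e6] at e3
  have e7 := integral_mul_eq_integral_comp_flow_add hF hFc hφ hρ hρc hu t
  rw [intervalIntegral.integral_of_le ht] at e7
  simp only [Function.comp_apply] at e5
  linarith

/-- If `A` and all its preimages under the flow up to time `t` lie in a set `Q` on which `ρ` and
`∇·(F ρ)` are nonnegative, then the mass that the source puts into `A` in time `t` is at most the
mass of `ρ` on `A`. -/
lemma lintegral_divergence_le (hF : ContDiff ℝ 1 F)
    (hFc : HasCompactSupport F) (hφ : IsCompleteFlow F φ) (hρ : ContDiff ℝ 1 ρ)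
    (hρc : HasCompactSupport ρ) {Q : Set (EucSpace n)} (hQ : ∀ x ∈ Q, 0 ≤ ρ x)
    (hQw : ∀ᵐ x ∂(volume.restrict Q), 0 ≤ divergence (fun y => ρ y • F y) x)
    {t : ℝ} (ht : 0 ≤ t) {A : Set (EucSpace n)} (hA : MeasurableSet A)
    (hAQ : ∀ τ ∈ Icc 0 t, φ τ ⁻¹' A ⊆ Q) :
    ∫⁻ τ in Ioc 0 t, ∫⁻ x in φ τ ⁻¹' A, ENNReal.ofReal (divergence (fun y => ρ y • F y) x) ≤
      ∫⁻ x in A, ENNReal.ofReal (ρ x) := by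
  obtain ⟨K, hK⟩ := ContDiff.lipschitzWith_of_hasCompactSupport hFc hF one_ne_zero
  set w := divergence fun y => ρ y • F y with hw
  have hwc : Continuous w := continuous_divergence (hρ.smul hF)
  have hws : HasCompactSupport w := hasCompactSupport_divergence hρc.smul_right
  have hφt : ∀ τ, Measurable (φ τ) := fun τ => (hφ.lipschitzWith hK τ).continuous.measurable
  have i3 := isFiniteMeasure_posPartMeasure hwc hws
  have i4 : IsFiniteMeasure (posPartMeasure fun x => -w x) :=
    isFiniteMeasure_posPartMeasure hwc.neg hws.neg
  have h := congrArg (fun μ : Measure (EucSpace n) => μ A)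
    (posPartMeasure_add_map_add_accumulatedMeasure hF hFc hφ hρ hρc ht)
  simp only [Measure.add_apply, Measure.map_apply (hφt t) hA, ← hw,
    accumulatedMeasure_apply (hφ.continuous hK) t hA] at h
  rw [posPartMeasure_apply _ hA, posPartMeasure_apply _ (hφt t hA)] at h
  -- the negative parts vanish on the preimages of `A`
  have z1 : ∫⁻ x in φ t ⁻¹' A, ENNReal.ofReal (-ρ x) = 0 := by
    refine (setLIntegral_congr_fun (hφt t hA) fun x hx => ?_).trans lintegral_zero
    exact ENNReal.ofReal_of_nonpos (by linarith [hQ x (hAQ t ⟨ht, le_rfl⟩ hx)])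
  have z2 : ∫⁻ τ in Ioc 0 t, ∫⁻ x in φ τ ⁻¹' A, ENNReal.ofReal (-w x) = 0 := by
    refine (setLIntegral_congr_fun measurableSet_Ioc fun τ hτ => ?_).trans lintegral_zero
    refine (lintegral_congr_ae ?_).trans lintegral_zero
    filter_upwards [ae_restrict_of_ae_restrict_of_subset (hAQ τ ⟨hτ.1.le, hτ.2⟩) hQw] with x hx
    exact ENNReal.ofReal_of_nonpos (by linarith)
  rw [z1, z2, add_zero, add_zero] at h
  rw [h]
  exact le_add_self

end TransportMeasure

/-! ### The occupation measure is dominated by the density -/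

section Occupation

variable {n : ℕ} {φ : ℝ → EucSpace n → EucSpace n} {F : EucSpace n → EucSpace n}
  {ρ : EucSpace n → ℝ} {Q : Set (EucSpace n)} {R : Set (ℝ × EucSpace n)}

/-- The bound for finitely many residence times. At each step the largest time `a` is used for the
points of `A` that have residence time `a`, the smaller ones for the rest of `A`. -/
lemma measure_finset_residence_le (hF : ContDiff ℝ 1 F)
    (hFc : HasCompactSupport F) (hφ : IsCompleteFlow F φ) (hρ : ContDiff ℝ 1 ρ)
    (hρc : HasCompactSupport ρ) (hQ : ∀ x ∈ Q, 0 ≤ ρ x)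
    (hQw : ∀ᵐ x ∂(volume.restrict Q), 0 ≤ divergence (fun y => ρ y • F y) x)
    (hR : MeasurableSet R) (hRQ : ∀ τ y, (τ, y) ∈ R → ∀ σ ∈ Icc 0 τ, φ (-σ) y ∈ Q)
    (S : Finset ℝ) : ∀ {A : Set (EucSpace n)}, MeasurableSet A →
    ((volume : Measure ℝ).prod (posPartMeasure (divergence fun y => ρ y • F y)))
      {q | 0 < q.1 ∧ φ q.1 q.2 ∈ A ∧ ∃ a ∈ S, q.1 ≤ a ∧ (a, φ q.1 q.2) ∈ R} ≤
      posPartMeasure ρ A := by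
  obtain ⟨K, hK⟩ := ContDiff.lipschitzWith_of_hasCompactSupport hFc hF one_ne_zero
  have hφm := (hφ.continuous hK).measurable
  have i1 : IsFiniteMeasure (posPartMeasure (divergence fun y => ρ y • F y)) :=
    isFiniteMeasure_posPartMeasure (continuous_divergence (hρ.smul hF))
      (hasCompactSupport_divergence hρc.smul_right)
  induction S using Finset.induction_on_max with
  | empty => intro A _; simp
  | insert a S ha ih =>
    intro A hA
    have hRa : MeasurableSet {y | (a, y) ∈ R} := hR.preimage (by fun_prop)
    have hsub : {q : ℝ × EucSpace n | 0 < q.1 ∧ φ q.1 q.2 ∈ A ∧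
          ∃ b ∈ insert a S, q.1 ≤ b ∧ (b, φ q.1 q.2) ∈ R} ⊆
        {q | 0 < q.1 ∧ q.1 ≤ a ∧ φ q.1 q.2 ∈ A ∩ {y | (a, y) ∈ R}} ∪
        {q | 0 < q.1 ∧ φ q.1 q.2 ∈ A \ {y | (a, y) ∈ R} ∧
          ∃ b ∈ S, q.1 ≤ b ∧ (b, φ q.1 q.2) ∈ R} := by
      rintro ⟨τ, x⟩ ⟨h0, hxA, b, hb, hτb, hbR⟩
      by_cases hx : (a, φ τ x) ∈ R
      · refine Or.inl ⟨h0, ?_, hxA, hx⟩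
        rcases Finset.mem_insert.1 hb with rfl | hb
        · exact hτb
        · exact hτb.trans (ha b hb).le
      · refine Or.inr ⟨h0, ⟨hxA, hx⟩, b, ?_, hτb, hbR⟩
        rcases Finset.mem_insert.1 hb with rfl | hb
        · exact absurd hbR hx
        · exact hb
    have hfirst : ((volume : Measure ℝ).prod (posPartMeasure (divergence fun y => ρ y • F y)))
        {q | 0 < q.1 ∧ q.1 ≤ a ∧ φ q.1 q.2 ∈ A ∩ {y | (a, y) ∈ R}} ≤
        posPartMeasure ρ (A ∩ {y | (a, y) ∈ R}) := by
      rcases lt_or_ge a 0 with ha0 | ha0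
      · have : {q : ℝ × EucSpace n | 0 < q.1 ∧ q.1 ≤ a ∧ φ q.1 q.2 ∈ A ∩ {y | (a, y) ∈ R}} = ∅ := by
          ext q; simp only [mem_ofPred_eq, mem_empty_iff_false, iff_false]
          rintro ⟨h1, h2, _⟩; linarith
        rw [this, measure_empty]
        exact zero_le
      · have hA' := hA.inter hRa
        rw [posPartMeasure_apply ρ hA']
        refine le_trans (le_of_eq ?_) (lintegral_divergence_le hF hFc hφ hρ hρc hQ hQw ha0 hA' ?_)
        · rw [← accumulatedMeasure_apply (hφ.continuous hK) a hA', accumulatedMeasure,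
            Measure.map_apply hφm hA', ← Measure.restrict_univ (μ := posPartMeasure _),
            Measure.prod_restrict, Measure.restrict_apply (hφm hA'), Measure.restrict_univ]
          congr 1
          ext q
          simp only [mem_ofPred_eq, mem_inter_iff, mem_preimage, mem_prod, mem_Ioc, mem_univ]
          tauto
        · intro τ hτ x hx
          have := hRQ a (φ τ x) hx.2 τ hτ
          rwa [hφ.neg_apply hK] at this
    calc _ ≤ _ := measure_mono hsub
      _ ≤ _ := measure_union_le _ _
      _ ≤ posPartMeasure ρ (A ∩ {y | (a, y) ∈ R}) + posPartMeasure ρ (A \ {y | (a, y) ∈ R}) :=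
        add_le_add hfirst (ih (hA.diff hRa))
      _ = posPartMeasure ρ A := measure_inter_add_sdiff _ hRa

/-- Times `τ` that are maximal in the residence interval of `φ τ x` do not contribute: each point
has at most one of them, and the flow maps preserve null sets. -/
lemma measure_maximal_residence_eq_zero {K : NNReal} (hK : LipschitzWith K F)
    (hφ : IsCompleteFlow F φ) {μ : Measure (EucSpace n)} [SFinite μ] (hμ : μ ≪ volume)
    (hR : MeasurableSet R)
    (hRdown : ∀ τ y, (τ, y) ∈ R → ∀ σ ∈ Icc 0 τ, (σ, y) ∈ R) :
    ((volume : Measure ℝ).prod μ)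
      {q | 0 < q.1 ∧ (q.1, φ q.1 q.2) ∈ R ∧
        ∀ a : ℚ, q.1 ≤ a → ((a : ℝ), φ q.1 q.2) ∉ R} = 0 := by
  set Z : Set (ℝ × EucSpace n) :=
    {q | 0 < q.1 ∧ (q.1, q.2) ∈ R ∧ ∀ a : ℚ, q.1 ≤ a → ((a : ℝ), q.2) ∉ R} with hZ
  have hZm : MeasurableSet Z := by
    have h1 : MeasurableSet {q : ℝ × EucSpace n | 0 < q.1} :=
      measurableSet_lt measurable_const measurable_fst
    have h2 : MeasurableSet {q : ℝ × EucSpace n | ∀ a : ℚ, q.1 ≤ a → ((a : ℝ), q.2) ∉ R} := by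
      rw [ofPred_forall]
      refine MeasurableSet.iInter fun a => ?_
      have h3 : MeasurableSet {q : ℝ × EucSpace n | q.1 ≤ a} :=
        measurableSet_le measurable_fst measurable_const
      have h4 : MeasurableSet {q : ℝ × EucSpace n | ((a : ℝ), q.2) ∈ R} :=
        hR.preimage (by fun_prop)
      have : {q : ℝ × EucSpace n | q.1 ≤ a → ((a : ℝ), q.2) ∉ R} =
          {q | q.1 ≤ (a : ℝ)}ᶜ ∪ {q | ((a : ℝ), q.2) ∈ R}ᶜ := by
        ext q; simp [imp_iff_not_or]
      rw [this]
      exact h3.compl.union h4.compl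
    exact h1.inter (hR.inter h2)
  have hsing : ∀ y, {τ | (τ, y) ∈ Z}.Subsingleton := by
    intro y τ₁ h₁ τ₂ h₂
    by_contra hne
    wlog hlt : τ₁ < τ₂ generalizing τ₁ τ₂
    · exact this h₂ h₁ (Ne.symm hne) (lt_of_le_of_ne (not_lt.1 hlt) (Ne.symm hne))
    obtain ⟨a, ha1, ha2⟩ := exists_rat_btwn hlt
    exact h₁.2.2 a ha1.le (hRdown τ₂ y h₂.2.1 a ⟨(h₁.1.trans ha1).le, ha2.le⟩)
  have hZ0 : ((volume : Measure ℝ).prod (volume : Measure (EucSpace n))) Z = 0 := by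
    rw [Measure.prod_apply_symm hZm]
    refine (lintegral_congr fun y => ?_).trans lintegral_zero
    exact (hsing y).measure_zero _
  have hae := Measure.measure_ae_null_of_prod_null hZ0
  have hpre : MeasurableSet {q : ℝ × EucSpace n | (q.1, φ q.1 q.2) ∈ Z} :=
    hZm.preimage (measurable_fst.prodMk (hφ.continuous hK).measurable)
  refine (Measure.measure_prod_null hpre).2 ?_
  filter_upwards [hae] with τ hτ
  exact hμ ((hφ.quasiMeasurePreserving hK τ).preimage_null hτ)

/-- Let `R` be a measurable set of pairs `(τ, y)` such that the backward flow line of `y` stays up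
to time `τ` in a set `Q` on which `ρ` and its source `∇·(F ρ)` are nonnegative. Then the mass
created by the source and found at the points `y` at age `τ`, `(τ, y) ∈ R`, is dominated by `ρ`. -/
lemma lintegral_occupation_le (hF : ContDiff ℝ 1 F)
    (hFc : HasCompactSupport F) (hφ : IsCompleteFlow F φ) (hρ : ContDiff ℝ 1 ρ)
    (hρc : HasCompactSupport ρ) (hQ : ∀ x ∈ Q, 0 ≤ ρ x)
    (hQw : ∀ᵐ x ∂(volume.restrict Q), 0 ≤ divergence (fun y => ρ y • F y) x)
    (hR : MeasurableSet R) (hRQ : ∀ τ y, (τ, y) ∈ R → ∀ σ ∈ Icc 0 τ, φ (-σ) y ∈ Q)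
    (hRdown : ∀ τ y, (τ, y) ∈ R → ∀ σ ∈ Icc 0 τ, (σ, y) ∈ R)
    {S : Set (EucSpace n)} (hS : MeasurableSet S) (hRS : ∀ τ y, (τ, y) ∈ R → y ∈ S)
    {f : EucSpace n → ENNReal} (hf : Measurable f) :
    ∫⁻ q in {q : ℝ × EucSpace n | 0 < q.1 ∧ (q.1, φ q.1 q.2) ∈ R}, f (φ q.1 q.2)
      ∂((volume : Measure ℝ).prod (posPartMeasure (divergence fun y => ρ y • F y))) ≤
    ∫⁻ y in S, f y ∂posPartMeasure ρ := by
  obtain ⟨K, hK⟩ := ContDiff.lipschitzWith_of_hasCompactSupport hFc hF one_ne_zero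
  have hφm := (hφ.continuous hK).measurable
  have i1 : IsFiniteMeasure (posPartMeasure (divergence fun y => ρ y • F y)) :=
    isFiniteMeasure_posPartMeasure (continuous_divergence (hρ.smul hF))
      (hasCompactSupport_divergence hρc.smul_right)
  set ν := (volume : Measure ℝ).prod (posPartMeasure (divergence fun y => ρ y • F y)) with hν
  set D := {q : ℝ × EucSpace n | 0 < q.1 ∧ (q.1, φ q.1 q.2) ∈ R} with hD
  suffices hle : (ν.restrict D).map (fun q => φ q.1 q.2) ≤ (posPartMeasure ρ).restrict S by
    rw [← lintegral_map (μ := ν.restrict D) hf hφm]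
    exact lintegral_mono' hle le_rfl
  refine Measure.le_iff.2 fun A hA => ?_
  rw [Measure.map_apply hφm hA, Measure.restrict_apply (hφm hA), Measure.restrict_apply hA]
  obtain ⟨e, he⟩ := exists_surjective_nat ℚ
  set B : ℕ → Set (ℝ × EucSpace n) := fun k =>
    {q | 0 < q.1 ∧ φ q.1 q.2 ∈ A ∩ S ∧
      ∃ a ∈ (Finset.range k).image (fun i => (e i : ℝ)), q.1 ≤ a ∧ (a, φ q.1 q.2) ∈ R} with hB
  have hBle : ∀ k, ν (B k) ≤ posPartMeasure ρ (A ∩ S) := fun k =>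
    measure_finset_residence_le hF hFc hφ hρ hρc hQ hQw hR hRQ _ (hA.inter hS)
  have hBmono : Monotone B := by
    intro k l hkl q ⟨h0, h1, a, ha, h2⟩
    exact ⟨h0, h1, a, Finset.image_subset_image (Finset.range_mono hkl) ha, h2⟩
  have hnull := measure_maximal_residence_eq_zero hK hφ
    (μ := posPartMeasure (divergence fun y => ρ y • F y))
    (withDensity_absolutelyContinuous _ _) hR hRdown
  have hcover : (fun q : ℝ × EucSpace n => φ q.1 q.2) ⁻¹' A ∩ D ⊆
      (⋃ k, B k) ∪ {q | 0 < q.1 ∧ (q.1, φ q.1 q.2) ∈ R ∧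
        ∀ a : ℚ, q.1 ≤ a → ((a : ℝ), φ q.1 q.2) ∉ R} := by
    rintro q ⟨hqA, hq0, hqR⟩
    by_cases h : ∀ a : ℚ, q.1 ≤ a → ((a : ℝ), φ q.1 q.2) ∉ R
    · exact Or.inr ⟨hq0, hqR, h⟩
    · push Not at h
      obtain ⟨a, ha1, ha2⟩ := h
      obtain ⟨i, rfl⟩ := he a
      refine Or.inl (mem_iUnion.2 ⟨i + 1, hq0, ⟨hqA, hRS _ _ hqR⟩, (e i : ℝ), ?_, ha1, ha2⟩)
      exact Finset.mem_image.2 ⟨i, Finset.self_mem_range_succ i, rfl⟩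
  calc ν ((fun q : ℝ × EucSpace n => φ q.1 q.2) ⁻¹' A ∩ D)
      ≤ ν (⋃ k, B k) + 0 := by
        rw [← hnull]; exact (measure_mono hcover).trans (measure_union_le _ _)
    _ = ⨆ k, ν (B k) := by rw [add_zero, hBmono.measure_iUnion]
    _ ≤ posPartMeasure ρ (A ∩ S) := iSup_le hBle

end Occupation

/-! ### Cutoffs, exhaustion and uniqueness of solutions -/

section Localization

variable {E : Type*} [NormedAddCommGroup E] [NormedSpace ℝ E] [FiniteDimensional ℝ E]

/-- A `C¹` map on an open set `W` agrees near a given compact subset of `W` with a compactly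
supported `C¹` map on the whole space. -/
lemma exists_contDiff_compactSupport_eventuallyEq {Y : Type*} [NormedAddCommGroup Y]
    [NormedSpace ℝ Y] {W L : Set E} (hW : IsOpen W) (hL : IsCompact L) (hLW : L ⊆ W) {g : E → Y}
    (hg : ContDiffOn ℝ 1 g W) :
    ∃ g' : E → Y, ContDiff ℝ 1 g' ∧ HasCompactSupport g' ∧ ∀ x ∈ L, g' =ᶠ[𝓝 x] g := by
  obtain ⟨L', hL', hLL', hL'W⟩ := exists_compact_between hL hW hLW
  obtain ⟨f, hf1, hf0, -⟩ := exists_contMDiffMap_one_nhds_of_subset_interior (n := 1)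
    (modelWithCornersSelf ℝ E) hL.isClosed hLL'
  have hfc : ContDiff ℝ 1 f := f.contMDiff.contDiff
  have hsupp : tsupport (fun x => f x • g x) ⊆ L' := by
    refine closure_minimal (fun x hx => ?_) hL'.isClosed
    by_contra hxL
    exact hx (by simp [hf0 x hxL])
  refine ⟨fun x => f x • g x, ?_, HasCompactSupport.of_support_subset_isCompact hL'
    (subset_closure.trans hsupp), fun x hx => ?_⟩
  · refine contDiff_iff_contDiffAt.2 fun x => ?_
    by_cases hx : x ∈ W
    · exact hfc.contDiffAt.smul (hg.contDiffAt (hW.mem_nhds hx))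
    · have h0 : (fun x => f x • g x) =ᶠ[𝓝 x] fun _ => 0 := by
        filter_upwards [hL'.isClosed.isOpen_compl.mem_nhds fun h => hx (hL'W h)] with y hy
        simp [hf0 y hy]
      exact contDiffAt_const.congr_of_eventuallyEq h0
  · filter_upwards [(eventually_nhdsSet_iff_forall.1 hf1) x hx] with y hy
    simp [hy]

lemma exists_compact_exhaustion {W : Set E} (hW : IsOpen W) :
    ∃ L : ℕ → Set E, Monotone L ∧ (∀ m, IsCompact (L m)) ∧ (∀ m, L m ⊆ W) ∧
      ∀ A, IsCompact A → A ⊆ W → ∃ m, A ⊆ L m := by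
  have : LocallyCompactSpace W := hW.locallyCompactSpace
  let c := CompactExhaustion.choice W
  refine ⟨fun m => Subtype.val '' c m, fun k l hkl => image_mono (c.subset hkl),
    fun m => (c.isCompact m).image continuous_subtype_val, fun m => ?_, fun A hA hAW => ?_⟩
  · rintro _ ⟨y, _, rfl⟩; exact y.2
  · have h1 : IsCompact (Subtype.val ⁻¹' A : Set W) :=
      (Topology.IsInducing.subtypeVal.isCompact_preimage_iff (by simpa using hAW)).2 hA
    obtain ⟨m, hm⟩ := c.exists_superset_of_isCompact h1
    exact ⟨m, fun x hx => ⟨⟨x, hAW hx⟩, hm hx, rfl⟩⟩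

/-- Two forward solutions with the same initial value that stay in the open set on which the field
is `C¹` coincide. The field is cut off near the two orbits to make it globally Lipschitz. -/
lemma eqOn_Icc_of_solutions {U : Set E} (hU : IsOpen U) {F : E → E} (hF : ContDiffOn ℝ 1 F U)
    {y z : ℝ → E} {T : ℝ} (hyc : ContinuousOn y (Icc 0 T)) (hzc : ContinuousOn z (Icc 0 T))
    (hyU : ∀ t ∈ Icc 0 T, y t ∈ U) (hzU : ∀ t ∈ Icc 0 T, z t ∈ U)
    (hy : ∀ t ∈ Ico 0 T, HasDerivWithinAt y (F (y t)) (Ici t) t)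
    (hz : ∀ t ∈ Ico 0 T, HasDerivWithinAt z (F (z t)) (Ici t) t) (h0 : y 0 = z 0) :
    EqOn y z (Icc 0 T) := by
  have hL : IsCompact (y '' Icc 0 T ∪ z '' Icc 0 T) :=
    (isCompact_Icc.image_of_continuousOn hyc).union (isCompact_Icc.image_of_continuousOn hzc)
  have hLU : y '' Icc 0 T ∪ z '' Icc 0 T ⊆ U := by
    rintro _ (⟨t, ht, rfl⟩ | ⟨t, ht, rfl⟩)
    exacts [hyU t ht, hzU t ht]
  obtain ⟨G, hG, hGc, hGF⟩ := exists_contDiff_compactSupport_eventuallyEq hU hL hLU hF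
  obtain ⟨K, hK⟩ := ContDiff.lipschitzWith_of_hasCompactSupport hGc hG one_ne_zero
  refine ODE_solution_unique (v := fun _ => G) (fun _ => hK) hyc (fun t ht => ?_) hzc
    (fun t ht => ?_) h0
  · rw [(hGF (y t) (Or.inl ⟨t, Ico_subset_Icc_self ht, rfl⟩)).eq_of_nhds]; exact hy t ht
  · rw [(hGF (z t) (Or.inr ⟨t, Ico_subset_Icc_self ht, rfl⟩)).eq_of_nhds]; exact hz t ht

end Localization

section SolutionFlow

variable {n : ℕ} {F : EucSpace n → EucSpace n} {X : Set (EucSpace n)}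
  {s : ℝ → EucSpace n → EucSpace n}

namespace IsSolutionFlow

lemma continuousOn_Icc (hs : IsSolutionFlow F X s) {x : EucSpace n} (hx : x ∈ X) (T : ℝ) :
    ContinuousOn (fun t => s t x) (Icc 0 T) := fun t ht =>
  ((hs.deriv x hx t ht.1).continuousWithinAt).mono Icc_subset_Ici_self

lemma hasDerivWithinAt_Ici (hs : IsSolutionFlow F X s) {x : EucSpace n} (hx : x ∈ X) {t : ℝ}
    (ht : 0 ≤ t) : HasDerivWithinAt (fun τ => s τ x) (F (s t x)) (Ici t) t :=
  (hs.deriv x hx t ht).mono (Ici_subset_Ici.2 ht)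

lemma add (hs : IsSolutionFlow F X s) (hF : IsC1On F X) {x : EucSpace n} (hx : x ∈ X) {a b : ℝ}
    (ha : 0 ≤ a) (hb : 0 ≤ b) : s (a + b) x = s b (s a x) := by
  obtain ⟨U, hU, hXU, hFU⟩ := hF
  have hsa := hs.mem x hx a ha
  have hd : ∀ t, 0 ≤ t → HasDerivWithinAt (fun τ => s (a + τ) x) (F (s (a + t) x)) (Ici 0) t := by
    intro t ht
    have h1 := hs.deriv x hx (a + t) (by linarith)
    have h2 : HasDerivWithinAt (fun τ => a + τ) 1 (Ici 0) t :=
      ((hasDerivAt_id t).const_add a).hasDerivWithinAt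
    have := h1.scomp t h2 fun τ hτ => by simp only [mem_Ici] at hτ ⊢; linarith
    simpa [Function.comp_def] using this
  exact eqOn_Icc_of_solutions hU hFU (T := b) (y := fun t => s (a + t) x)
    (z := fun t => s t (s a x))
    (fun t ht => ((hd t ht.1).continuousWithinAt).mono Icc_subset_Ici_self)
    (hs.continuousOn_Icc hsa b) (fun t ht => hXU (hs.mem x hx _ (by linarith [ht.1])))
    (fun t ht => hXU (hs.mem _ hsa t ht.1))
    (fun t ht => (hd t ht.1).mono (Ici_subset_Ici.2 ht.1))
    (fun t ht => hs.hasDerivWithinAt_Ici hsa ht.1) (by simp [hs.initial _ hsa]) ⟨hb, le_rfl⟩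

variable {G : EucSpace n → EucSpace n} {φ : ℝ → EucSpace n → EucSpace n} {L : Set (EucSpace n)}
  {K : NNReal}

/-- While a solution stays in a set where `F` agrees with the complete field `G`, it is a flow line
of `G`. -/
lemma eq_flow (hs : IsSolutionFlow F X s) (hφ : IsCompleteFlow G φ) (hK : LipschitzWith K G)
    (hGF : ∀ x ∈ L, G x = F x) {x : EucSpace n} (hx : x ∈ X) {T : ℝ}
    (hL : ∀ t ∈ Icc 0 T, s t x ∈ L) : ∀ t ∈ Icc 0 T, s t x = φ t x := by
  have := hφ.eqOn_of_hasDerivWithinAt hK (y := fun t => s t x) (hs.continuousOn_Icc hx T)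
    fun t ht => by
      rw [hGF _ (hL t (Ico_subset_Icc_self ht))]
      exact hs.hasDerivWithinAt_Ici hx ht.1
  intro t ht
  simpa [hs.initial x hx] using this ht

/-- Conversely, while a flow line of `G` starting in `X` stays in a subset of the domain of `F`
where `F` agrees with `G`, it is the solution given by `s`. -/
lemma eq_of_flow (hs : IsSolutionFlow F X s) (hφ : IsCompleteFlow G φ) {U : Set (EucSpace n)}
    (hU : IsOpen U) (hXU : X ⊆ U) (hFU : ContDiffOn ℝ 1 F U) (hLU : L ⊆ U)
    (hGF : ∀ x ∈ L, G x = F x) {x : EucSpace n} (hx : x ∈ X) {T : ℝ}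
    (hL : ∀ t ∈ Icc 0 T, φ t x ∈ L) : ∀ t ∈ Icc 0 T, s t x = φ t x :=
  eqOn_Icc_of_solutions hU hFU (y := fun t => s t x) (z := fun t => φ t x)
    (hs.continuousOn_Icc hx T) (hφ.continuous_time x).continuousOn
    (fun t ht => hXU (hs.mem x hx t ht.1)) (fun t ht => hLU (hL t ht))
    (fun t ht => hs.hasDerivWithinAt_Ici hx ht.1)
    (fun t ht => by
      rw [← hGF _ (hL t (Ico_subset_Icc_self ht))]
      exact (hφ.hasDerivAt x t).hasDerivWithinAt)
    (by simp [hs.initial x hx, hφ.zero])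

end IsSolutionFlow

/-- A compactly supported `C¹` field has a complete flow. -/
lemma exists_isCompleteFlow_of_hasCompactSupport {G : EucSpace n → EucSpace n}
    (hG : ContDiff ℝ 1 G) (hGc : HasCompactSupport G) :
    ∃ φ : ℝ → EucSpace n → EucSpace n, IsCompleteFlow G φ := by
  obtain ⟨K, hK⟩ := ContDiff.lipschitzWith_of_hasCompactSupport hGc hG one_ne_zero
  obtain ⟨M, hM⟩ := hGc.exists_bound_of_continuous hG.continuous
  exact exists_isCompleteFlow hK (M := M.toNNReal) fun x => (hM x).trans (Real.le_coe_toNNReal M)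

/-- The time-`t` solution map pulls Lebesgue null sets back to null subsets of `X`. -/
lemma IsSolutionFlow.volume_preimage_eq_zero (hs : IsSolutionFlow F X s) (hF : IsC1On F X)
    {t : ℝ} (ht : 0 ≤ t) {A : Set (EucSpace n)} (hA : volume A = 0) :
    volume {x | x ∈ X ∧ s t x ∈ A} = 0 := by
  obtain ⟨U, hU, hXU, hFU⟩ := hF
  obtain ⟨L, hLmono, hLc, hLU, hLex⟩ := exists_compact_exhaustion hU
  choose G hG hGc hGF using fun m =>
    exists_contDiff_compactSupport_eventuallyEq hU (hLc m) (hLU m) hFU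
  choose φ hφ using fun m => exists_isCompleteFlow_of_hasCompactSupport (hG m) (hGc m)
  choose K hK using fun m =>
    ContDiff.lipschitzWith_of_hasCompactSupport (hGc m) (hG m) one_ne_zero
  have hsub : {x | x ∈ X ∧ s t x ∈ A} ⊆ ⋃ m, φ m t ⁻¹' A := by
    rintro x ⟨hx, hxA⟩
    obtain ⟨m, hm⟩ := hLex ((fun τ => s τ x) '' Icc 0 t)
      (isCompact_Icc.image_of_continuousOn (hs.continuousOn_Icc hx t))
      (by rintro _ ⟨τ, hτ, rfl⟩; exact hXU (hs.mem x hx τ hτ.1))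
    refine mem_iUnion.2 ⟨m, ?_⟩
    have := hs.eq_flow (hφ m) (hK m) (fun y hy => (hGF m y hy).eq_of_nhds) hx
      (fun τ hτ => hm ⟨τ, hτ, rfl⟩) t ⟨ht, le_rfl⟩
    rwa [mem_preimage, ← this]
  exact measure_mono_null hsub (measure_iUnion_null fun m =>
    ((hφ m).quasiMeasurePreserving (hK m) t).preimage_null hA)

end SolutionFlow

/-! ### Occupation bound for the solutions in the state space -/

section StateSpace

variable {n : ℕ} {F : EucSpace n → EucSpace n} {X N : Set (EucSpace n)}
  {s : ℝ → EucSpace n → EucSpace n} {h₀ ρ : EucSpace n → ℝ}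

instance sFinite_densityMeasure (h : EucSpace n → ℝ) (X : Set (EucSpace n)) :
    SFinite (densityMeasure h X) := by
  unfold densityMeasure; infer_instance

lemma divergence_congr {V V' : EucSpace n → EucSpace n} {x : EucSpace n} (h : V =ᶠ[𝓝 x] V') :
    divergence V x = divergence V' x := by
  simp only [divergence, h.fderiv_eq]

/-- The set of pairs `(τ, x)` for which the solution through `x` is outside `N` at time `τ`. Since
`N` is positively invariant, it has then been outside `N` since time `0`. -/
def outsideSet (s : ℝ → EucSpace n → EucSpace n) (X N : Set (EucSpace n)) :
    Set (ℝ × EucSpace n) :=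
  {q | 0 < q.1 ∧ q.2 ∈ X ∧ s q.1 q.2 ∈ X \ N}

/-- The part of `outsideSet` where the solution has stayed in `L` so far. -/
def outsideSetWithin (s : ℝ → EucSpace n → EucSpace n) (X N L : Set (EucSpace n)) :
    Set (ℝ × EucSpace n) :=
  {q | q ∈ outsideSet s X N ∧ ∀ σ ∈ Icc 0 q.1, s σ q.2 ∈ L}

lemma isClosed_setOf_forall_flow_mem {φ : ℝ → EucSpace n → EucSpace n}
    (hφ : Continuous fun q : ℝ × EucSpace n => φ q.1 q.2) {L : Set (EucSpace n)}
    (hL : IsClosed L) :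
    IsClosed {q : ℝ × EucSpace n | ∀ θ ∈ Icc (0 : ℝ) 1, φ (-(θ * q.1)) q.2 ∈ L} := by
  have : {q : ℝ × EucSpace n | ∀ θ ∈ Icc (0 : ℝ) 1, φ (-(θ * q.1)) q.2 ∈ L} =
      ⋂ θ ∈ Icc (0 : ℝ) 1, {q | φ (-(θ * q.1)) q.2 ∈ L} := by
    ext q; simp
  rw [this]
  refine isClosed_biInter fun θ _ => hL.preimage ?_
  exact hφ.comp (f := fun q : ℝ × EucSpace n => (-(θ * q.1), q.2)) (by fun_prop)

/-- The occupation bound for the solutions that stay in a set `L` on which the data agree with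
compactly supported data `G`, `ρ'` defined on the whole space. -/
lemma lintegral_outsideSetWithin_le (hX : MeasurableSet X) (hF : IsC1On F X)
    (hs : IsSolutionFlow F X s) (hN : MeasurableSet N)
    (hinv : ∀ x ∈ N, ∀ t : ℝ, 0 ≤ t → s t x ∈ N) (hh₀ : ∀ x ∈ X, 0 ≤ h₀ x)
    (hρ0 : ∀ x ∈ X \ N, 0 ≤ ρ x)
    (hdiv : ∀ᵐ x ∂(volume.restrict (X \ N)), divergence (fun y => ρ y • F y) x = h₀ x)
    {G : EucSpace n → EucSpace n} (hG : ContDiff ℝ 1 G) (hGc : HasCompactSupport G)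
    {φ : ℝ → EucSpace n → EucSpace n} (hφ : IsCompleteFlow G φ)
    {ρ' : EucSpace n → ℝ} (hρ' : ContDiff ℝ 1 ρ') (hρc' : HasCompactSupport ρ')
    {L U : Set (EucSpace n)} (hU : IsOpen U) (hXU : X ⊆ U) (hFU : ContDiffOn ℝ 1 F U)
    (hLU : L ⊆ U) (hLc : IsClosed L) (hGF : ∀ x ∈ L, G =ᶠ[𝓝 x] F)
    (hρL : ∀ x ∈ L, ρ' =ᶠ[𝓝 x] ρ) {f : EucSpace n → ENNReal} (hf : Measurable f) :
    MeasurableSet (outsideSetWithin s X N L) ∧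
    AEMeasurable (fun q : ℝ × EucSpace n => f (s q.1 q.2))
      (((volume : Measure ℝ).prod (densityMeasure h₀ X)).restrict (outsideSetWithin s X N L)) ∧
    ∫⁻ q in outsideSetWithin s X N L, f (s q.1 q.2)
      ∂((volume : Measure ℝ).prod (densityMeasure h₀ X)) ≤
      ∫⁻ y in X \ N, f y * ENNReal.ofReal (ρ y) := by
  obtain ⟨K, hK⟩ := ContDiff.lipschitzWith_of_hasCompactSupport hGc hG one_ne_zero
  have hφc := hφ.continuous hK
  have hXN := hX.diff hN
  -- For `τ ≥ 0`, the last condition says that `φ (-σ) y ∈ L` for all `σ ∈ [0, τ]`; with `θ = σ / τ`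
  -- it is an intersection of closed sets.
  set R : Set (ℝ × EucSpace n) := {q | 0 ≤ q.1 ∧ q.2 ∈ X \ N ∧ φ (-q.1) q.2 ∈ X ∧
    ∀ θ ∈ Icc (0 : ℝ) 1, φ (-(θ * q.1)) q.2 ∈ L} with hRdef
  have hRL : ∀ τ y, (τ, y) ∈ R → ∀ σ ∈ Icc 0 τ, φ (-σ) y ∈ L := by
    rintro τ y ⟨h0, _, _, hL⟩ σ ⟨hσ0, hστ⟩
    rcases h0.eq_or_lt with h | h
    · have h1 : τ = 0 := h.symm
      have h2 : σ = 0 := by linarith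
      have := hL 0 ⟨le_rfl, zero_le_one⟩
      simpa [h2] using this
    · have := hL (σ / τ) ⟨by positivity, (div_le_one h).2 hστ⟩
      simpa [div_mul_cancel₀ σ h.ne'] using this
  -- the backward orbit of `y` is the solution that starts at `φ (-τ) y`
  have hRs : ∀ τ y, (τ, y) ∈ R → ∀ σ ∈ Icc 0 τ, s σ (φ (-τ) y) = φ (σ - τ) y := by
    intro τ y hR σ hσ
    have hfl : ∀ σ, φ σ (φ (-τ) y) = φ (σ - τ) y := fun σ => by
      rw [← hφ.add hK, sub_eq_add_neg]
    rw [hs.eq_of_flow hφ hU hXU hFU hLU (fun x hx => (hGF x hx).eq_of_nhds) hR.2.2.1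
      (T := τ) (fun t ht => ?_) σ hσ, hfl]
    have := hRL τ y hR (τ - t) ⟨by linarith [ht.2], by linarith [ht.1]⟩
    rwa [neg_sub, ← hfl] at this
  -- it cannot have been in `N`, since `y` is outside the positively invariant set `N`
  have hRX : ∀ τ y, (τ, y) ∈ R → ∀ σ ∈ Icc 0 τ, φ (-σ) y ∈ X \ N := by
    intro τ y hR σ hσ
    have e1 := hRs τ y hR (τ - σ) ⟨by linarith [hσ.2], by linarith [hσ.1]⟩
    have e2 := hRs τ y hR τ ⟨hR.1, le_rfl⟩
    rw [sub_self, hφ.zero] at e2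
    rw [sub_sub_cancel_left] at e1
    rw [← e1]
    refine ⟨hs.mem _ hR.2.2.1 _ (by linarith [hσ.2]), fun hmem => hR.2.1.2 ?_⟩
    have h3 := hinv _ hmem σ hσ.1
    rwa [← hs.add hF hR.2.2.1 (by linarith [hσ.2]) hσ.1, sub_add_cancel, e2] at h3
  have hRdown : ∀ τ y, (τ, y) ∈ R → ∀ σ ∈ Icc 0 τ, (σ, y) ∈ R := by
    intro τ y hR σ hσ
    refine ⟨hσ.1, hR.2.1, (hRX τ y hR σ hσ).1, fun θ hθ => hRL τ y hR _ ?_⟩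
    exact ⟨mul_nonneg hθ.1 hσ.1, by nlinarith [hθ.2, hσ.1, hσ.2]⟩
  have hRm : MeasurableSet R := by
    refine (measurableSet_le measurable_const measurable_fst).inter
      ((hXN.preimage measurable_snd).inter (MeasurableSet.inter ?_ ?_))
    · exact hX.preimage (hφc.comp (f := fun q : ℝ × EucSpace n => (-q.1, q.2))
        (by fun_prop)).measurable
    · exact (isClosed_setOf_forall_flow_mem hφc hLc).measurableSet
  have hDR : outsideSetWithin s X N L =
      {q : ℝ × EucSpace n | 0 < q.1 ∧ (q.1, φ q.1 q.2) ∈ R} := by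
    ext ⟨τ, x⟩
    constructor
    · rintro ⟨⟨h0, hx, hsx⟩, hL⟩
      have heq := hs.eq_flow hφ hK (fun y hy => (hGF y hy).eq_of_nhds) hx hL
      have h0' : 0 ≤ τ := h0.le
      refine ⟨h0, h0', ?_, ?_, fun θ hθ => ?_⟩
      · change φ τ x ∈ X \ N
        rw [← heq τ ⟨h0', le_rfl⟩]; exact hsx
      · change φ (-τ) (φ τ x) ∈ X
        rwa [hφ.neg_apply hK]
      · change φ (-(θ * τ)) (φ τ x) ∈ L
        have hm : -(θ * τ) + τ ∈ Icc 0 τ := ⟨by nlinarith [hθ.2], by nlinarith [hθ.1]⟩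
        rw [← hφ.add hK, ← heq _ hm]
        exact hL _ hm
    · rintro ⟨h0, hR⟩
      change 0 < τ at h0
      change (τ, φ τ x) ∈ R at hR
      have hx : x ∈ X := by simpa [hφ.neg_apply hK] using hR.2.2.1
      have e := hRs τ _ hR
      rw [hφ.neg_apply hK] at e
      have e2 : s τ x = φ τ x := by simpa [hφ.zero] using e τ ⟨h0.le, le_rfl⟩
      refine ⟨⟨h0, hx, ?_⟩, fun σ hσ => ?_⟩
      · change s τ x ∈ X \ N
        rw [e2]; exact hR.2.1
      · change s σ x ∈ L
        have := hRL τ _ hR (τ - σ) ⟨by linarith [hσ.2], by linarith [hσ.1]⟩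
        rwa [neg_sub, ← e σ hσ] at this
  have hDm : MeasurableSet (outsideSetWithin s X N L) := by
    rw [hDR]
    exact (measurableSet_lt measurable_const measurable_fst).inter
      (hRm.preimage (measurable_fst.prodMk hφc.measurable))
  have hDeq : ∀ q ∈ outsideSetWithin s X N L, s q.1 q.2 = φ q.1 q.2 := fun q hq =>
    hs.eq_flow hφ hK (fun y hy => (hGF y hy).eq_of_nhds) hq.1.2.1 hq.2 q.1 ⟨hq.1.1.le, le_rfl⟩
  have hfφ : Measurable fun q : ℝ × EucSpace n => f (φ q.1 q.2) := hf.comp hφc.measurable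
  refine ⟨hDm, hfφ.aemeasurable.congr ?_, ?_⟩
  · filter_upwards [ae_restrict_mem hDm] with q hq
    rw [hDeq q hq]
  -- on `Q`, the source of the truncated data is `h₀`
  set Q := (X \ N) ∩ L with hQdef
  have hQm : MeasurableSet Q := hXN.inter hLc.measurableSet
  have hdivQ : ∀ᵐ x ∂(volume.restrict Q),
      divergence (fun y => ρ' y • G y) x = h₀ x := by
    filter_upwards [ae_restrict_of_ae_restrict_of_subset inter_subset_left hdiv,
      ae_restrict_mem hQm] with x hx hxQ
    rw [← hx]
    exact divergence_congr ((hρL x hxQ.2).smul (hGF x hxQ.2))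
  have hQw : ∀ᵐ x ∂(volume.restrict Q), 0 ≤ divergence (fun y => ρ' y • G y) x := by
    filter_upwards [hdivQ, ae_restrict_mem hQm] with x hx hxQ
    rw [hx]; exact hh₀ x hxQ.1.1
  have hρQ : ∀ x ∈ Q, ρ' x = ρ x := fun x hx => (hρL x hx.2).eq_of_nhds
  have main := lintegral_occupation_le hG hGc hφ hρ' hρc' (Q := Q)
    (fun x hx => by rw [hρQ x hx]; exact hρ0 x hx.1) hQw hRm
    (fun τ y hR σ hσ => ⟨hRX τ y hR σ hσ, hRL τ y hR σ hσ⟩) hRdown hQm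
    (fun τ y hR => ⟨hR.2.1, by simpa [hφ.zero] using hRL τ y hR 0 ⟨le_rfl, hR.1⟩⟩) hf
  have hmeas : (posPartMeasure (divergence fun y => ρ' y • G y)).restrict Q =
      (densityMeasure h₀ X).restrict Q := by
    rw [posPartMeasure, densityMeasure, restrict_withDensity hQm, restrict_withDensity hQm,
      Measure.restrict_restrict hQm, inter_eq_self_of_subset_left
        (inter_subset_left.trans sdiff_subset : Q ⊆ X)]
    refine withDensity_congr_ae ?_
    filter_upwards [hdivQ] with x hx
    rw [hx]
  have hprod : ∀ ν : Measure (EucSpace n), SFinite ν →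
      ((volume : Measure ℝ).prod ν).restrict (outsideSetWithin s X N L) =
      ((volume : Measure ℝ).prod (ν.restrict Q)).restrict (outsideSetWithin s X N L) := by
    intro ν _
    have hsub : outsideSetWithin s X N L ⊆ univ ×ˢ Q := by
      rintro ⟨τ, x⟩ hq
      have hx : x ∈ X := hq.1.2.1
      have h0 : (0 : ℝ) ≤ τ := hq.1.1.le
      refine ⟨trivial, ⟨hx, fun hxN => hq.1.2.2.2 (hinv x hxN τ h0)⟩, ?_⟩
      simpa [hs.initial x hx] using hq.2 0 ⟨le_rfl, h0⟩
    rw [← Measure.restrict_restrict_of_subset hsub, ← Measure.prod_restrict,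
      Measure.restrict_univ]
  have i1 : IsFiniteMeasure (posPartMeasure (divergence fun y => ρ' y • G y)) :=
    isFiniteMeasure_posPartMeasure (continuous_divergence (hρ'.smul hG))
      (hasCompactSupport_divergence hρc'.smul_right)
  calc ∫⁻ q in outsideSetWithin s X N L, f (s q.1 q.2)
        ∂((volume : Measure ℝ).prod (densityMeasure h₀ X))
      = ∫⁻ q in outsideSetWithin s X N L, f (φ q.1 q.2)
        ∂((volume : Measure ℝ).prod (densityMeasure h₀ X)) :=
        setLIntegral_congr_fun hDm fun q hq => by simp only [hDeq q hq]
    _ = ∫⁻ q in outsideSetWithin s X N L, f (φ q.1 q.2)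
        ∂((volume : Measure ℝ).prod (posPartMeasure (divergence fun y => ρ' y • G y))) := by
        rw [hprod _ inferInstance, hprod (posPartMeasure _) inferInstance, hmeas]
    _ ≤ ∫⁻ y in Q, f y ∂posPartMeasure ρ' := by rw [hDR]; exact main
    _ = ∫⁻ y in Q, f y * ENNReal.ofReal (ρ y) := by
        rw [posPartMeasure, setLIntegral_withDensity_eq_setLIntegral_mul volume
          hρ'.continuous.measurable.ennreal_ofReal hf hQm]
        refine setLIntegral_congr_fun hQm fun y hy => ?_
        simp only [Pi.mul_apply, hρQ y hy, mul_comm]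
    _ ≤ ∫⁻ y in X \ N, f y * ENNReal.ofReal (ρ y) := lintegral_mono_set inter_subset_left

/-- The occupation measure of the region outside `N` is dominated by `ρ`. -/
lemma lintegral_outsideSet_le (hX : MeasurableSet X) (hF : IsC1On F X)
    (hs : IsSolutionFlow F X s) (hN : MeasurableSet N)
    (hinv : ∀ x ∈ N, ∀ t : ℝ, 0 ≤ t → s t x ∈ N) (hh₀ : ∀ x ∈ X, 0 ≤ h₀ x)
    (hρ : IsC1On ρ (X \ N)) (hρ0 : ∀ x ∈ X \ N, 0 ≤ ρ x)
    (hdiv : ∀ᵐ x ∂(volume.restrict (X \ N)), divergence (fun y => ρ y • F y) x = h₀ x)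
    {f : EucSpace n → ENNReal} (hf : Measurable f) :
    MeasurableSet (outsideSet s X N) ∧
    AEMeasurable (fun q : ℝ × EucSpace n => f (s q.1 q.2))
      (((volume : Measure ℝ).prod (densityMeasure h₀ X)).restrict (outsideSet s X N)) ∧
    ∫⁻ q in outsideSet s X N, f (s q.1 q.2)
      ∂((volume : Measure ℝ).prod (densityMeasure h₀ X)) ≤
      ∫⁻ y in X \ N, f y * ENNReal.ofReal (ρ y) := by
  have hF' := hF
  obtain ⟨U, hU, hXU, hFU⟩ := hF'
  obtain ⟨V, hV, hXV, hρV⟩ := hρ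
  have hW := hU.inter hV
  obtain ⟨L, hLmono, hLc, hLW, hLex⟩ := exists_compact_exhaustion hW
  choose G hG hGc hGF using fun m =>
    exists_contDiff_compactSupport_eventuallyEq hW (hLc m) (hLW m) (hFU.mono inter_subset_left)
  choose ρ' hρ' hρc' hρρ using fun m =>
    exists_contDiff_compactSupport_eventuallyEq hW (hLc m) (hLW m) (hρV.mono inter_subset_right)
  choose φ hφ using fun m => exists_isCompleteFlow_of_hasCompactSupport (hG m) (hGc m)
  have key := fun m => lintegral_outsideSetWithin_le hX hF hs hN hinv hh₀ hρ0 hdiv (hG m) (hGc m)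
    (hφ m) (hρ' m) (hρc' m) hU hXU hFU ((hLW m).trans inter_subset_left) (hLc m).isClosed
    (hGF m) (hρρ m) hf
  have hunion : outsideSet s X N = ⋃ m, outsideSetWithin s X N (L m) := by
    ext ⟨τ, x⟩
    simp only [mem_iUnion]
    refine ⟨fun hq => ?_, fun ⟨m, hm⟩ => hm.1⟩
    have hx : x ∈ X := hq.2.1
    obtain ⟨m, hm⟩ := hLex ((fun σ => s σ x) '' Icc 0 τ)
      (isCompact_Icc.image_of_continuousOn (hs.continuousOn_Icc hx τ)) (by
        rintro _ ⟨σ, hσ, rfl⟩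
        have h1 := hs.mem x hx σ hσ.1
        refine ⟨hXU h1, hXV ⟨h1, fun h2 => hq.2.2.2 ?_⟩⟩
        have h3 := hinv _ h2 (τ - σ) (by linarith [hσ.2])
        rwa [← hs.add hF hx hσ.1 (by linarith [hσ.2]), add_sub_cancel] at h3)
    exact ⟨m, hq, fun σ hσ => hm ⟨σ, hσ, rfl⟩⟩
  have hmono : Monotone fun m => outsideSetWithin s X N (L m) := fun k l hkl q hq =>
    ⟨hq.1, fun σ hσ => hLmono hkl (hq.2 σ hσ)⟩
  refine ⟨?_, ?_, ?_⟩
  · rw [hunion]; exact MeasurableSet.iUnion fun m => (key m).1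
  · rw [hunion]; exact aemeasurable_iUnion_iff.2 fun m => (key m).2.1
  · rw [hunion, setLIntegral_iUnion_of_directed _ hmono.directed_le]
    exact iSup_le fun m => (key m).2.2

end StateSpace

/-! ### Almost everywhere stability and the collision bound -/

section Conclusions

variable {n : ℕ} {F : EucSpace n → EucSpace n} {X N : Set (EucSpace n)}
  {s : ℝ → EucSpace n → EucSpace n} {h₀ p ρ : EucSpace n → ℝ}

lemma ae_densityMeasure_iff (hh₀ : Measurable h₀) {P : EucSpace n → Prop} :
    (∀ᵐ x ∂densityMeasure h₀ X, P x) ↔ ∀ᵐ x ∂(volume.restrict X), 0 < h₀ x → P x := by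
  rw [densityMeasure, ae_withDensity_iff hh₀.ennreal_ofReal]
  simp only [ne_eq, ENNReal.ofReal_eq_zero, not_le]

lemma ae_mem_densityMeasure (hX : MeasurableSet X) : ∀ᵐ x ∂densityMeasure h₀ X, x ∈ X :=
  (withDensity_absolutelyContinuous _ _).ae_le (ae_restrict_mem hX)

/-- A solution that enters `N` converges to the origin. -/
lemma tendsto_zero_of_mem (hF : IsC1On F X) (hs : IsSolutionFlow F X s)
    (hN : IsLocallyStableWithDomain F X s N) {x : EucSpace n} (hx : x ∈ X) {t : ℝ} (ht : 0 ≤ t)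
    (hxN : s t x ∈ N) : Tendsto (fun τ => s τ x) atTop (𝓝 0) := by
  have h1 : Tendsto (fun τ => s (τ - t) (s t x)) atTop (𝓝 0) :=
    (hN.attracted _ hxN).comp (tendsto_atTop_add_const_right atTop (-t) tendsto_id)
  refine h1.congr' ?_
  filter_upwards [eventually_ge_atTop t] with τ hτ
  rw [← hs.add hF hx ht (by linarith), add_sub_cancel]

/-- The time spent outside `N` is integrable with respect to the initial measure, hence finite for
almost every initial point, which therefore enters `N`. -/
lemma ae_tendsto_zero (hX : MeasurableSet X) (hF : IsC1On F X)
    (hs : IsSolutionFlow F X s) (hNm : MeasurableSet N)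
    (hN : IsLocallyStableWithDomain F X s N) (hh₀ : IsProbDensityOn h₀ X)
    (hρ : IsC1On ρ (X \ N)) (hρ0 : ∀ x ∈ X \ N, 0 ≤ ρ x) (hρi : IntegrableOn ρ (X \ N))
    (hdiv : ∀ᵐ x ∂(volume.restrict (X \ N)), divergence (fun y => ρ y • F y) x = h₀ x) :
    ∀ᵐ x ∂densityMeasure h₀ X, Tendsto (fun t => s t x) atTop (𝓝 0) := by
  obtain ⟨hD, -, hle⟩ := lintegral_outsideSet_le hX hF hs hNm hN.invariant hh₀.nonneg hρ hρ0 hdiv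
    (f := fun _ => 1) measurable_const
  simp only [one_mul, setLIntegral_const] at hle
  have hfin : ((volume : Measure ℝ).prod (densityMeasure h₀ X)) (outsideSet s X N) ≠ ⊤ := by
    refine (lt_of_le_of_lt hle ?_).ne
    exact lt_of_le_of_lt (lintegral_mono fun x => Real.ofReal_le_enorm (ρ x)) hρi.2
  rw [Measure.prod_apply_symm hD] at hfin
  have hae := ae_lt_top (measurable_measure_prodMk_right hD) hfin
  filter_upwards [hae, ae_mem_densityMeasure hX] with x hx hxX
  have hex : ∃ t : ℝ, 0 < t ∧ s t x ∈ N := by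
    by_contra hcon
    push Not at hcon
    have hsub : Ioi (0 : ℝ) ⊆ (fun t => (t, x)) ⁻¹' outsideSet s X N := fun t ht =>
      ⟨ht, hxX, hs.mem x hxX t (le_of_lt ht), hcon t ht⟩
    have := lt_of_le_of_lt (measure_mono hsub) hx
    simp at this
  obtain ⟨t, ht, htN⟩ := hex
  exact tendsto_zero_of_mem hF hs hN hxX ht.le htN

lemma collisionProb_indicator_le (hX : MeasurableSet X) (hF : IsC1On F X)
    (hs : IsSolutionFlow F X s) (hNm : MeasurableSet N)
    (hinv : ∀ x ∈ N, ∀ t : ℝ, 0 ≤ t → s t x ∈ N) (hh₀ : IsProbDensityOn h₀ X)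
    (hp : IsProbDensityOn p X)
    (hρ : IsC1On ρ (X \ N)) (hρ0 : ∀ x ∈ X \ N, 0 ≤ ρ x)
    (hdiv : ∀ᵐ x ∂(volume.restrict (X \ N)), divergence (fun y => ρ y • F y) x = h₀ x)
    (hpρ : IntegrableOn (fun x => p x * ρ x) (X \ N)) :
    collisionProb s (densityMeasure h₀ X) ((X \ N).indicator p) ≤
      ENNReal.ofReal (∫ x in X \ N, p x * ρ x) := by
  obtain ⟨hD, hmeas, hle⟩ := lintegral_outsideSet_le hX hF hs hNm hinv hh₀.nonneg hρ hρ0 hdiv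
    (f := fun x => ENNReal.ofReal (p x)) hp.measurable.ennreal_ofReal
  have hrhs : ∫⁻ y in X \ N, ENNReal.ofReal (p y) * ENNReal.ofReal (ρ y) =
      ENNReal.ofReal (∫ x in X \ N, p x * ρ x) := by
    rw [ofReal_integral_eq_lintegral_ofReal hpρ]
    · refine setLIntegral_congr_fun (hX.diff hNm) fun y hy => ?_
      exact (ENNReal.ofReal_mul (hp.nonneg y hy.1)).symm
    · filter_upwards [ae_restrict_mem (hX.diff hNm)] with y hy
      exact mul_nonneg (hp.nonneg y hy.1) (hρ0 y hy)
  rw [← hrhs]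
  refine le_trans (le_of_eq ?_) hle
  rw [← lintegral_indicator hD, lintegral_prod _ ((aemeasurable_indicator_iff hD).2 hmeas),
    collisionProb, ← lintegral_indicator measurableSet_Ioi]
  refine lintegral_congr fun t => ?_
  by_cases ht : t ∈ Ioi (0 : ℝ)
  · rw [indicator_of_mem ht]
    refine lintegral_congr_ae ?_
    filter_upwards [ae_mem_densityMeasure hX] with x hx
    by_cases hmem : s t x ∈ X \ N
    · rw [indicator_of_mem hmem, indicator_of_mem (show (t, x) ∈ outsideSet s X N from
        ⟨ht, hx, hmem⟩)]
    · rw [indicator_of_notMem hmem, indicator_of_notMem (show (t, x) ∉ outsideSet s X N from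
        fun h => hmem h.2.2), ENNReal.ofReal_zero]
  · rw [indicator_of_notMem ht]
    refine ((lintegral_congr fun x => ?_).trans lintegral_zero).symm
    exact indicator_of_notMem (fun h => ht h.1) _

/-- If `p` vanishes almost everywhere on `N`, truncating it to the complement of `N` does not change
the probability of collision, because solution maps pull null sets back to null sets. -/
lemma collisionProb_indicator_eq (hX : MeasurableSet X) (hF : IsC1On F X)
    (hs : IsSolutionFlow F X s) (hNm : MeasurableSet N)
    (hpN : ∀ᵐ x ∂(volume.restrict N), p x = 0) :
    collisionProb s (densityMeasure h₀ X) ((X \ N).indicator p) =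
      collisionProb s (densityMeasure h₀ X) p := by
  refine setLIntegral_congr_fun measurableSet_Ioi fun t ht => lintegral_congr_ae ?_
  have hnull : volume {x | x ∈ N ∧ p x ≠ 0} = 0 := by
    rw [ae_restrict_iff' hNm] at hpN
    refine measure_mono_null (fun x hx => ?_) hpN
    exact fun h => hx.2 (h hx.1)
  have hae : ∀ᵐ x, x ∈ X → s t x ∉ {x | x ∈ N ∧ p x ≠ 0} := by
    have := hs.volume_preimage_eq_zero hF (le_of_lt ht) hnull
    refine measure_mono_null (fun x hx => ?_) this
    simpa only [mem_compl_iff, mem_ofPred_eq, Classical.not_imp, not_not] using hx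
  have hac : densityMeasure h₀ X ≪ volume :=
    (withDensity_absolutelyContinuous _ _).trans Measure.restrict_le_self.absolutelyContinuous
  filter_upwards [hac.ae_le hae, ae_mem_densityMeasure hX] with x hx hxX
  by_cases hmem : s t x ∈ X \ N
  · rw [indicator_of_mem hmem]
  · rw [indicator_of_notMem hmem]
    have h1 : s t x ∈ N := by
      by_contra h; exact hmem ⟨hs.mem x hxX t (le_of_lt ht), h⟩
    have h2 : p (s t x) = 0 := by
      by_contra h; exact hx hxX ⟨h1, h⟩
    rw [h2]

end Conclusions

/-! ### Linearity and convexity of the feasibility problem -/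

section Convexity

variable {n : ℕ} {F : EucSpace n → EucSpace n} {Z : Set (EucSpace n)} {h₀ p : EucSpace n → ℝ}

lemma IsC1On.differentiableAt {Y : Type*} [NormedAddCommGroup Y] [NormedSpace ℝ Y]
    {g : EucSpace n → Y} (hg : IsC1On g Z) {x : EucSpace n} (hx : x ∈ Z) :
    DifferentiableAt ℝ g x := by
  obtain ⟨U, hU, hZU, hgU⟩ := hg
  exact (hgU.differentiableOn one_ne_zero).differentiableAt (hU.mem_nhds (hZU hx))

lemma divergence_add_mul_smul {ρ₁ ρ₂ : EucSpace n → ℝ} {x : EucSpace n}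
    (h₁ : DifferentiableAt ℝ ρ₁ x) (h₂ : DifferentiableAt ℝ ρ₂ x) (hF : DifferentiableAt ℝ F x)
    (a b : ℝ) :
    divergence (fun y => (a * ρ₁ y + b * ρ₂ y) • F y) x =
      a * divergence (fun y => ρ₁ y • F y) x + b * divergence (fun y => ρ₂ y • F y) x := by
  have e : (fun y => (a * ρ₁ y + b * ρ₂ y) • F y) =
      fun y => a • (ρ₁ y • F y) + b • (ρ₂ y • F y) := by
    funext y; rw [add_smul, mul_smul, mul_smul]
  have d₁ : DifferentiableAt ℝ (fun y => ρ₁ y • F y) x := h₁.smul hF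
  have d₂ : DifferentiableAt ℝ (fun y => ρ₂ y • F y) x := h₂.smul hF
  have hd : fderiv ℝ (fun y => a • (ρ₁ y • F y) + b • (ρ₂ y • F y)) x =
      a • fderiv ℝ (fun y => ρ₁ y • F y) x + b • fderiv ℝ (fun y => ρ₂ y • F y) x :=
    ((d₁.hasFDerivAt.const_smul a).add (d₂.hasFDerivAt.const_smul b)).fderiv
  rw [e]
  simp only [divergence, hd, Finset.mul_sum, ← Finset.sum_add_distrib]
  rfl

lemma integral_mul_add_mul {ρ₁ ρ₂ : EucSpace n → ℝ}
    (h₁ : IntegrableOn (fun x => p x * ρ₁ x) Z) (h₂ : IntegrableOn (fun x => p x * ρ₂ x) Z)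
    (a b : ℝ) :
    ∫ x in Z, p x * (a * ρ₁ x + b * ρ₂ x) =
      a * (∫ x in Z, p x * ρ₁ x) + b * (∫ x in Z, p x * ρ₂ x) := by
  rw [← integral_const_mul, ← integral_const_mul,
    ← integral_add (h₁.const_mul a) (h₂.const_mul b)]
  refine integral_congr_ae (.of_forall fun x => ?_)
  simp only
  ring

lemma convex_feasibleDensities (hZ : MeasurableSet Z) (hF : IsC1On F Z) (γ : ℝ) :
    Convex ℝ (feasibleDensities F Z h₀ p γ) := by
  rintro ρ₁ ⟨c₁, n₁, i₁, d₁, j₁, g₁⟩ ρ₂ ⟨c₂, n₂, i₂, d₂, j₂, g₂⟩ a b ha hb hab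
  change (fun x => a * ρ₁ x + b * ρ₂ x) ∈ feasibleDensities F Z h₀ p γ
  have c₁' := c₁
  have c₂' := c₂
  obtain ⟨U, hU, hZU, hU1⟩ := c₁'
  obtain ⟨V, hV, hZV, hV1⟩ := c₂'
  refine ⟨⟨U ∩ V, hU.inter hV, subset_inter hZU hZV, ?_⟩, fun x hx => ?_, ?_, ?_, ?_, ?_⟩
  · exact (contDiffOn_const.mul (hU1.mono inter_subset_left)).add
      (contDiffOn_const.mul (hV1.mono inter_subset_right))
  · have := n₁ x hx
    have := n₂ x hx
    positivity
  · exact (i₁.const_mul a).add (i₂.const_mul b)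
  · filter_upwards [d₁, d₂, ae_restrict_mem hZ] with x e₁ e₂ hx
    rw [divergence_add_mul_smul (c₁.differentiableAt hx) (c₂.differentiableAt hx)
      (hF.differentiableAt hx), e₁, e₂, ← add_mul, hab, one_mul]
  · refine ((j₁.const_mul a).add (j₂.const_mul b)).congr (.of_forall fun x => ?_)
    simp only [Pi.add_apply]
    ring
  · rw [integral_mul_add_mul j₁ j₂]
    calc _ ≤ a * γ + b * γ := by gcongr
      _ = γ := by rw [← add_mul, hab, one_mul]

end Convexity

end

theorem theorem2 {n : ℕ}
    -- state space, vector field and solutions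
    (X : Set (EucSpace n)) (hX : MeasurableSet X)
    (F : EucSpace n → EucSpace n) (hF : IsC1On F X)
    (s : ℝ → EucSpace n → EucSpace n) (hs : IsSolutionFlow F X s)
    -- local stability of the target, with local domain of attraction `N`
    (N : Set (EucSpace n)) (hN : MeasurableSet N)
    (hstable : IsLocallyStableWithDomain F X s N)
    -- initial set and initial density supported on it
    (X₀ : Set (EucSpace n)) (hX₀ : MeasurableSet X₀) (hX₀X : X₀ ⊆ X)
    (h₀ : EucSpace n → ℝ) (hh₀ : IsProbDensityOn h₀ X)
    (hsupp : ∀ᵐ x ∂(MeasureTheory.volume.restrict X), x ∈ X₀ ↔ 0 < h₀ x)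
    -- density that describes the unsafe set
    (p : EucSpace n → ℝ) (hp : IsProbDensityOn p X) (γ : ℝ) :
    -- every feasible density certifies safe navigation
    (∀ ρ ∈ feasibleDensities F (X \ N) h₀ p γ,
      SolvesSafeNavigation s X₀ (densityMeasure h₀ X) ((X \ N).indicator p) γ ∧
      ((∀ᵐ x ∂(MeasureTheory.volume.restrict N), p x = 0) →
        SolvesSafeNavigation s X₀ (densityMeasure h₀ X) p γ)) ∧
    -- the feasibility problem is convex, with constraints linear in the unknown
    Convex ℝ (feasibleDensities F (X \ N) h₀ p γ) ∧
    (∀ ρ₁ ρ₂ : EucSpace n → ℝ, IsC1On ρ₁ (X \ N) → IsC1On ρ₂ (X \ N) → ∀ a b : ℝ, ∀ x ∈ X \ N,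
      divergence (fun y => (a * ρ₁ y + b * ρ₂ y) • F y) x =
        a * divergence (fun y => ρ₁ y • F y) x + b * divergence (fun y => ρ₂ y • F y) x) ∧
    (∀ ρ₁ ρ₂ : EucSpace n → ℝ,
      MeasureTheory.IntegrableOn (fun x => p x * ρ₁ x) (X \ N) →
      MeasureTheory.IntegrableOn (fun x => p x * ρ₂ x) (X \ N) → ∀ a b : ℝ,
      ∫ x in X \ N, p x * (a * ρ₁ x + b * ρ₂ x) =
        a * (∫ x in X \ N, p x * ρ₁ x) + b * (∫ x in X \ N, p x * ρ₂ x)) := by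
  have hXN := hX.diff hN
  have hF₁ : IsC1On F (X \ N) := by
    obtain ⟨U, hU, hXU, hFU⟩ := hF
    exact ⟨U, hU, sdiff_subset.trans hXU, hFU⟩
  refine ⟨?_, convex_feasibleDensities hXN hF₁ γ, fun ρ₁ ρ₂ h₁ h₂ a b x hx =>
    divergence_add_mul_smul (h₁.differentiableAt hx) (h₂.differentiableAt hx)
      (hF₁.differentiableAt hx) a b, fun ρ₁ ρ₂ h₁ h₂ a b => integral_mul_add_mul h₁ h₂ a b⟩
  rintro ρ ⟨hρ, hρ0, hρi, hdiv, hpρ, hγ⟩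
  have hμ₀ := ae_tendsto_zero hX hF hs hN hstable hh₀ hρ hρ0 hρi hdiv
  have hX₀' : ∀ᵐ x ∂(volume.restrict X₀), Tendsto (fun t => s t x) atTop (𝓝 0) := by
    filter_upwards [ae_restrict_of_ae_restrict_of_subset hX₀X
        ((ae_densityMeasure_iff hh₀.measurable).1 hμ₀),
      ae_restrict_of_ae_restrict_of_subset hX₀X hsupp, ae_restrict_mem hX₀] with x h1 h2 h3
    exact h1 (h2.1 h3)
  have hcol := (collisionProb_indicator_le hX hF hs hN hstable.invariant hh₀ hp hρ hρ0 hdiv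
    hpρ).trans (ENNReal.ofReal_le_ofReal hγ)
  refine ⟨⟨hX₀', hμ₀, hcol⟩, fun hpN => ⟨hX₀', hμ₀, ?_⟩⟩
  rwa [← collisionProb_indicator_eq hX hF hs hN hpN]
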